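/- An oriented matroid on a finite set $E$ is given by its set of covectors in $\{-1,0,1\}^E$, satisfying the usual covector axioms. A strong map $\mathcal{M}_1\to\mathcal{M}_2$ exists if both oriented matroids have the same ground set and every covector of $\mathcal{M}_2$ is a covector of $\mathcal{M}_1$; its corank is $r(\mathcal{M}_1)-r(\mathcal{M}_2)$. It is factorizable if $\mathcal{M}_2$ can be obtained from $\mathcal{M}_1$ by a finite sequence of steps, each of which either adds one new element without changing the rank (a single extension: deleting the new element gives back the previous oriented matroid) or contracts one element not belonging to the ground set of $\mathcal{M}_1$. **Theorem.** There is a strong map $f:\mathcal{M}_1\to\mathcal{M}_2$ of corank $2$ between oriented matroids on $8$ elements, with $\mathcal{M}_1$ realizable of rank $4$, that is not factorizable into extensions and contractions. Explicitly, on the ground set $\{1,\dots,8\}$ one can take for $\mathcal{M}_1$ the alternating oriented matroid of rank $4$, with chirotope $\chi(e_1,e_2,e_3,e_4)=1$ for all $1\le e_1<e_2<e_3<e_4\le 8$, and for $\mathcal{M}_2$ the oriented matroid of rank $2$ whose chirotope is given, for $i\ne j$, by $\chi(i,j)=1$ if and only if $\sigma(i)>\sigma(j)$, where $\sigma=(1\,2)(3\,4)(5\,6)(7\,8)$.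 Moreover, for these $\mathcal{M}_1$ and $\mathcal{M}_2$ there is no uniform oriented matroid $\mathcal{M}'$ of rank $3$ such that $\mathcal{M}_1\to\mathcal{M}'$ and $\mathcal{M}'\to\mathcal{M}_2$ are both strong maps. -/

import Mathlib

/-- A signed vector: a map to `{-1, 0, 1}`. -/
abbrev SignedVec (α : Type*) := α → SignType

namespace SignedVec

variable {α : Type*}

/-- The composition `X ∘ Y`: equal to `X` where `X` is nonzero and to `Y` elsewhere. -/
def comp (X Y : SignedVec α) : SignedVec α := fun e => if X e ≠ 0 then X e else Y e

/-- The separation set `S(X, Y)`. -/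
def sep (X Y : SignedVec α) : Set α := {e | X e = -Y e ∧ X e ≠ 0}

/-- The conformal order `X ⪯ Y`: `X⁺ ⊆ Y⁺` and `X⁻ ⊆ Y⁻`. -/
def Conforms (X Y : SignedVec α) : Prop := ∀ e, X e ≠ 0 → Y e = X e

/-- The signed vector obtained from `X` by setting the entry at `u` to zero. -/
def zeroAt [DecidableEq α] (X : SignedVec α) (u : α) : SignedVec α := Function.update X u 0

end SignedVec

/-- An oriented matroid, given by its covectors, whose finite ground set consists of elements
of the ambient type `α`. A signed vector on the ground set is represented by its extension by
zero to `α`. -/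
@[ext]
structure OrientedMatroid (α : Type*) where
  /-- The ground set. -/
  ground : Finset α
  /-- The set of covectors. -/
  covectors : Set (SignedVec α)
  supported : ∀ X ∈ covectors, ∀ e, e ∉ ground → X e = 0
  zero_mem : (0 : SignedVec α) ∈ covectors
  neg_mem : ∀ X ∈ covectors, -X ∈ covectors
  comp_mem : ∀ X ∈ covectors, ∀ Y ∈ covectors, X.comp Y ∈ covectors
  elim : ∀ X ∈ covectors, ∀ Y ∈ covectors, ∀ e ∈ X.sep Y,
    ∃ Z ∈ covectors, Z e = 0 ∧ ∀ f, f ∉ X.sep Y → Z f = X.comp Y f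

namespace OrientedMatroid

variable {α : Type*}

/-- The rank: the minimal size of a set of elements that spans, that is, on which no nonzero
covector vanishes (equivalently, of a set contained in no hyperplane). -/
noncomputable def rank (M : OrientedMatroid α) : ℕ :=
  sInf {k | ∃ B : Finset α, B ⊆ M.ground ∧ B.card = k ∧
    ∀ X ∈ M.covectors, (∀ e ∈ B, X e = 0) → X = 0}

/-- Cocircuits: the nonzero covectors that are minimal for the conformal order. -/
def IsCocircuit (M : OrientedMatroid α) (X : SignedVec α) : Prop :=
  X ∈ M.covectors ∧ X ≠ 0 ∧ ∀ Y ∈ M.covectors, Y ≠ 0 → Y.Conforms X → Y = X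

/-- `χ` is a chirotope of `M` (one of the two, `χ` and `-χ`): it is an antisymmetric, not
identically zero function of `r` elements, where `r` is the rank of `M`, and the cocircuits
of `M` are, up to sign, exactly the nonzero signed vectors obtained from `χ` by fixing all
arguments but one. (It follows that `χ` vanishes as soon as one of its arguments lies outside
the ground set.) -/
structure IsChirotope [DecidableEq α] (M : OrientedMatroid α) {r : ℕ}
    (χ : (Fin r → α) → SignType) : Prop where
  rank_eq : M.rank = r
  antisymm : ∀ (x : Fin r → α) (i j : Fin r), i ≠ j → χ (x ∘ Equiv.swap i j) = -χ x
  exists_ne_zero : ∃ x, χ x ≠ 0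
  isCocircuit_iff : ∀ Y : SignedVec α, M.IsCocircuit Y ↔ Y ≠ 0 ∧
    ∃ (x : Fin r → α) (i : Fin r),
      (Y = fun e => χ (Function.update x i e)) ∨ (Y = fun e => -χ (Function.update x i e))

/-- `M` is uniform: its chirotope is nonzero at every tuple of distinct elements. -/
def IsUniform [DecidableEq α] (M : OrientedMatroid α) : Prop :=
  ∃ χ : (Fin M.rank → α) → SignType, M.IsChirotope χ ∧
    ∀ x, Function.Injective x → (∀ i, x i ∈ M.ground) → χ x ≠ 0

/-- `M` is realizable: up to reorientation of elements (by `ε`), it is the oriented matroid of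
a point configuration `p` affinely spanning `ℝᵈ`, whose covectors record on which side of the
affine hyperplane `⟨p, w⟩ = a` the points lie. -/
def IsRealizable [DecidableEq α] (M : OrientedMatroid α) : Prop :=
  ∃ (d : ℕ) (p : α → Fin d → ℝ) (ε : α → SignType),
    affineSpan ℝ (p '' (M.ground : Set α)) = ⊤ ∧ (∀ e, ε e ≠ 0) ∧
    M.covectors = {X | ∃ (w : Fin d → ℝ) (a : ℝ), ∀ e,
      X e = if e ∈ M.ground then ε e * SignType.sign (p e ⬝ᵥ w - a) else 0}

/-- The deletion `M \ u`: the covectors are the restrictions of the covectors of `M`. -/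
def delete [DecidableEq α] (M : OrientedMatroid α) (u : α) : OrientedMatroid α where
  ground := M.ground.erase u
  covectors := {X | ∃ Y ∈ M.covectors, X = Y.zeroAt u}
  supported := by
    rintro _ ⟨Y, hY, rfl⟩ e he
    by_cases h : e = u
    · simp [SignedVec.zeroAt, h]
    · simp only [SignedVec.zeroAt, Function.update_of_ne h]
      exact M.supported Y hY e (fun h' => he (Finset.mem_erase.2 ⟨h, h'⟩))
  zero_mem := ⟨0, M.zero_mem, by
    funext e
    by_cases h : e = u <;> simp [SignedVec.zeroAt, Function.update_apply]⟩
  neg_mem := by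
    rintro _ ⟨Y, hY, rfl⟩
    refine ⟨-Y, M.neg_mem Y hY, ?_⟩
    funext e
    by_cases h : e = u <;> simp [SignedVec.zeroAt, h]
  comp_mem := by
    rintro _ ⟨X, hX, rfl⟩ _ ⟨Y, hY, rfl⟩
    refine ⟨X.comp Y, M.comp_mem X hX Y hY, ?_⟩
    funext e
    by_cases h : e = u <;> simp [SignedVec.zeroAt, SignedVec.comp, h]
  elim := by
    rintro _ ⟨X, hX, rfl⟩ _ ⟨Y, hY, rfl⟩ e he
    have heu : e ≠ u := by
      rintro rfl
      simp [SignedVec.sep, SignedVec.zeroAt] at he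
    have he' : e ∈ X.sep Y := by
      simpa [SignedVec.sep, SignedVec.zeroAt, Function.update_apply, heu] using he
    obtain ⟨Z, hZ, hZe, hZf⟩ := M.elim X hX Y hY e he'
    refine ⟨Z.zeroAt u, ⟨Z, hZ, rfl⟩, ?_, ?_⟩
    · simp [SignedVec.zeroAt, Function.update_apply, hZe]
    · intro f hf
      by_cases h : f = u
      · simp [SignedVec.zeroAt, SignedVec.comp, h]
      · have hf' : f ∉ X.sep Y := by
          simpa [SignedVec.sep, SignedVec.zeroAt, Function.update_apply, h] using hf
        simpa [SignedVec.zeroAt, SignedVec.comp, Function.update_apply, h] using hZf f hf'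

/-- The contraction `M / u`: the covectors are the restrictions of those covectors of `M`
that vanish at `u`. -/
def contract [DecidableEq α] (M : OrientedMatroid α) (u : α) : OrientedMatroid α where
  ground := M.ground.erase u
  covectors := {X | X ∈ M.covectors ∧ X u = 0}
  supported := by
    rintro X ⟨hX, hXu⟩ e he
    by_cases h : e = u
    · rw [h, hXu]
    · exact M.supported X hX e (fun h' => he (Finset.mem_erase.2 ⟨h, h'⟩))
  zero_mem := ⟨M.zero_mem, rfl⟩
  neg_mem := fun X hX => ⟨M.neg_mem X hX.1, by simp [hX.2]⟩
  comp_mem := fun X hX Y hY => ⟨M.comp_mem X hX.1 Y hY.1, by simp [SignedVec.comp, hX.2, hY.2]⟩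
  elim := by
    rintro X ⟨hX, hXu⟩ Y ⟨hY, hYu⟩ e he
    obtain ⟨Z, hZ, hZe, hZf⟩ := M.elim X hX Y hY e he
    refine ⟨Z, ⟨hZ, ?_⟩, hZe, hZf⟩
    rw [hZf u (by simp [SignedVec.sep, hXu])]
    simp [SignedVec.comp, hXu, hYu]

/-- `N` is a single extension of `M`: it has one more element `u`, the same rank, and deleting
`u` gives back `M`. -/
def IsSingleExtension [DecidableEq α] (M N : OrientedMatroid α) : Prop :=
  ∃ u, u ∉ M.ground ∧ N.ground = insert u M.ground ∧ N.rank = M.rank ∧ N.delete u = M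

/-- There is a strong map `M₁ → M₂`: both have the same ground set, and every covector of `M₂`
is a covector of `M₁`. -/
def IsStrongMap (M₁ M₂ : OrientedMatroid α) : Prop :=
  M₁.ground = M₂.ground ∧ M₂.covectors ⊆ M₁.covectors

/-- The corank of a strong map `M₁ → M₂`. -/
noncomputable def corank (M₁ M₂ : OrientedMatroid α) : ℤ := (M₁.rank : ℤ) - (M₂.rank : ℤ)

/-- The map `M₁ → M₂` factors into extensions and contractions: `M₂` is reached from `M₁` by
finitely many steps, in any order, each of which is a single extension or the contraction of
an element outside the original ground set. The ambient type is infinite, so that there is no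
restriction on the number of new elements. -/
def IsFactorizable [DecidableEq α] [Infinite α] (M₁ M₂ : OrientedMatroid α) : Prop :=
  M₁.ground = M₂.ground ∧
  Relation.ReflTransGen (fun M N : OrientedMatroid α =>
    M.IsSingleExtension N ∨ ∃ u ∈ M.ground, u ∉ M₁.ground ∧ N = M.contract u) M₁ M₂

/-- `M` is the alternating oriented matroid of rank `r` on `[n] = {1, …, n}`: it has a chirotope
with value `1` at all increasing tuples. -/
def IsAlternating (M : OrientedMatroid ℕ) (r n : ℕ) : Prop :=
  M.ground = Finset.Icc 1 n ∧ ∃ χ : (Fin r → ℕ) → SignType, M.IsChirotope χ ∧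
    ∀ x, StrictMono x → (∀ i, x i ∈ Finset.Icc 1 n) → χ x = 1

/-- `M` is the rank 2 oriented matroid on `[n]` with the chirotope given by the permutation `σ`:
for distinct `i` and `j`, `χ(i, j) = 1` if and only if `σ(i) > σ(j)`. -/
def IsGivenByPerm (M : OrientedMatroid ℕ) (n : ℕ) (σ : Equiv.Perm ℕ) : Prop :=
  M.ground = Finset.Icc 1 n ∧ ∃ χ : (Fin 2 → ℕ) → SignType, M.IsChirotope χ ∧
    ∀ i ∈ Finset.Icc 1 n, ∀ j ∈ Finset.Icc 1 n, i ≠ j → (χ ![i, j] = 1 ↔ σ j < σ i)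

end OrientedMatroid

/-- The permutation `(1 2)(3 4)(5 6)(7 8)`. -/
def sigma8 : Equiv.Perm ℕ :=
  Equiv.swap 1 2 * Equiv.swap 3 4 * Equiv.swap 5 6 * Equiv.swap 7 8

/-!
There is no oriented matroid `M'` of rank three, uniform or not, with strong maps `M₁ → M' → M₂`
(`not_exists_rank_three`). Both negative statements follow. For the uniform one this is immediate.
For factorizability, restrict every oriented matroid of a factorization to the original ground set:
an extension does not change the restriction, a contraction gives a strong map and lowers the rank
of the restriction by at most one (`rank_restrict_le_contract`), so that one of the restrictions has
rank three (`IsFactorizable.exists_rank_eq`).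

The heart of the matter is a statement about six elements (`SixFrame.eq_and_ne_zero`): for three of
the pairs exchanged by the permutation, say `1, 2, 3, 4, 5, 6`, the covector of `M'` that vanishes at
`1` and `5` has equal nonzero signs at `2` and `6`. Otherwise, the covectors of `M₁` having at most
three sign changes, it is `(0, -, -, -, 0, +)` up to zeros at `2` and `6`. Eliminating with the
cocircuits `(0, -, +, +, +, +)`, `(-, -, +, 0, +, +)` and `(-, -, -, -, 0, -)` of `M₂` then produces a
covector that vanishes at `4` and `5` and, by uniqueness in rank three, has the form
`(+, ?, -, 0, 0, +)`, with too many sign changes.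

Both `M₁` and `M₂` are invariant under the shift of the elements by two places in which the elements
that pass the end change sign. Applying the statement to `5, 6, 7, 8, -1, -2` as well, the same
covector has opposite signs at `6` and `2`, a contradiction.

`M₁` and `M₂` are the oriented matroids of the sign vectors of the polynomials of degree less than
`4` and `2` (`polynomialOM`), for which the signs of Vandermonde determinants are a chirotope
(`isChirotope_vandermondeSign`).
-/

/-! ### Rank and spanning sets -/

namespace OrientedMatroid

variable {α : Type*}

/-- A set of elements spans if no nonzero covector vanishes on it. -/
def Spans (M : OrientedMatroid α) (B : Finset α) : Prop :=
  ∀ X ∈ M.covectors, (∀ e ∈ B, X e = 0) → X = 0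

lemma spans_ground (M : OrientedMatroid α) : M.Spans M.ground := fun X hX h => by
  funext e
  by_cases he : e ∈ M.ground
  · exact h e he
  · exact M.supported X hX e he

lemma exists_spans_card_eq_rank (M : OrientedMatroid α) :
    ∃ B ⊆ M.ground, B.card = M.rank ∧ M.Spans B := by
  obtain ⟨B, h1, h2, h3⟩ := Nat.sInf_mem (s := {k | ∃ B : Finset α, B ⊆ M.ground ∧ B.card = k ∧
    ∀ X ∈ M.covectors, (∀ e ∈ B, X e = 0) → X = 0}) ⟨_, M.ground, subset_rfl, rfl, M.spans_ground⟩
  exact ⟨B, h1, h2, h3⟩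

lemma rank_le_card {M : OrientedMatroid α} {B : Finset α} (hB : B ⊆ M.ground) (h : M.Spans B) :
    M.rank ≤ B.card :=
  Nat.sInf_le ⟨B, hB, rfl, h⟩

lemma exists_covector_of_card_lt_rank {M : OrientedMatroid α} {B : Finset α} (hB : B ⊆ M.ground)
    (h : B.card < M.rank) : ∃ X ∈ M.covectors, (∀ e ∈ B, X e = 0) ∧ X ≠ 0 := by
  by_contra! hc
  exact (rank_le_card hB hc).not_gt h

/-- Two covectors that are nonzero at `u` can be combined to a covector that vanishes at `u` and
agrees with the first at every zero of the second. -/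
lemma exists_elim_of_ne_zero {M : OrientedMatroid α} {X Y : SignedVec α} (hX : X ∈ M.covectors)
    (hY : Y ∈ M.covectors) {u : α} (hXu : X u ≠ 0) (hYu : Y u ≠ 0) :
    ∃ Z ∈ M.covectors, Z u = 0 ∧ ∀ f, Y f = 0 → Z f = X f := by
  have key : ∀ Y' ∈ M.covectors, (∀ f, Y f = 0 → Y' f = 0) → X u = -Y' u →
      ∃ Z ∈ M.covectors, Z u = 0 ∧ ∀ f, Y f = 0 → Z f = X f := by
    intro Y' hY' h0 hu
    obtain ⟨Z, hZ, hZu, hZf⟩ := M.elim X hX Y' hY' u ⟨hu, hXu⟩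
    refine ⟨Z, hZ, hZu, fun f hf => ?_⟩
    have hf' := h0 f hf
    rw [hZf f (by simp +contextual [SignedVec.sep, hf'])]
    by_cases h : X f = 0 <;> simp [SignedVec.comp, h, hf']
  have h3 : ∀ a b : SignType, a ≠ 0 → b ≠ 0 → a = -b ∨ a = - -b := by decide
  rcases h3 _ _ hXu hYu with h | h
  · exact key Y hY (fun _ h => h) h
  · exact key (-Y) (M.neg_mem Y hY) (fun f hf => by simp [hf]) h

/-- Steinitz exchange over a fixed set `S`: an element outside the closure of `S` can replace an
element of a set that spans together with `S`. -/
lemma exists_exchange [DecidableEq α] {M : OrientedMatroid α} {S B : Finset α}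
    (hB : M.Spans (S ∪ B)) {e : α} {X : SignedVec α} (hX : X ∈ M.covectors)
    (hXS : ∀ f ∈ S, X f = 0) (hXe : X e ≠ 0) :
    ∃ b ∈ B, M.Spans (insert e S ∪ B.erase b) := by
  classical
  -- `T` is a minimal subset of `B` with `e` in the closure of `S ∪ T`
  obtain ⟨T, hT, hmin⟩ := Finset.exists_minimal
    (s := B.powerset.filter fun T => ∀ Y ∈ M.covectors, (∀ f ∈ S ∪ T, Y f = 0) → Y e = 0)
    ⟨B, Finset.mem_filter.2 ⟨Finset.mem_powerset_self B, fun Y hY h => by rw [hB Y hY h]; rfl⟩⟩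
  simp only [Finset.mem_filter, Finset.mem_powerset] at hT hmin
  have hne : T.Nonempty := by
    rw [Finset.nonempty_iff_ne_empty]
    rintro rfl
    exact hXe (hT.2 X hX (by simpa using hXS))
  obtain ⟨b, hb⟩ := hne
  obtain ⟨Y, hY, hY0, hYe⟩ : ∃ Y ∈ M.covectors, (∀ f ∈ S ∪ T.erase b, Y f = 0) ∧ Y e ≠ 0 := by
    by_contra! hc
    exact (Finset.erase_ssubset hb).not_subset
      (hmin ⟨(Finset.erase_subset _ _).trans hT.1, hc⟩ (Finset.erase_subset _ _))
  have hYb : Y b ≠ 0 := by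
    intro h
    refine hYe (hT.2 Y hY fun f hf => ?_)
    by_cases hfb : f = b
    · rw [hfb, h]
    · exact hY0 f (by simp only [Finset.mem_union, Finset.mem_erase] at hf ⊢; tauto)
  refine ⟨b, hT.1 hb, fun Z hZ hZ0 => ?_⟩
  have hZe : Z e = 0 := hZ0 e (by simp)
  by_cases hZb : Z b = 0
  · refine hB Z hZ fun f hf => ?_
    by_cases hfb : f = b
    · rw [hfb, hZb]
    · exact hZ0 f (by simp only [Finset.mem_union, Finset.mem_erase, Finset.mem_insert] at hf ⊢; tauto)
  · exfalso
    obtain ⟨W, hW, hWb, hWf⟩ := exists_elim_of_ne_zero hY hZ hYb hZb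
    refine hYe ?_
    rw [← hWf e hZe]
    refine hT.2 W hW fun f hf => ?_
    by_cases hfb : f = b
    · rw [hfb, hWb]
    have hfT : f ∈ S ∪ T.erase b := by
      simp only [Finset.mem_union, Finset.mem_erase] at hf ⊢; tauto
    rw [hWf f (hZ0 f ?_), hY0 f hfT]
    simp only [Finset.mem_union, Finset.mem_erase, Finset.mem_insert] at hf ⊢
    have := @hT.1 f
    tauto

/-- In rank three, three independent elements span. -/
lemma eq_zero_of_rank_eq_three [DecidableEq α] {M : OrientedMatroid α} (hM : M.rank = 3)
    {i j k : α} {P Q R W : SignedVec α} (hP : P ∈ M.covectors) (hQ : Q ∈ M.covectors)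
    (hR : R ∈ M.covectors) (hW : W ∈ M.covectors) (hPi : P i ≠ 0) (hQi : Q i = 0) (hQj : Q j ≠ 0)
    (hRi : R i = 0) (hRj : R j = 0) (hRk : R k ≠ 0) (hWi : W i = 0) (hWj : W j = 0)
    (hWk : W k = 0) : W = 0 := by
  obtain ⟨B, -, hc, hB⟩ := M.exists_spans_card_eq_rank
  obtain ⟨b, hb, h1⟩ := exists_exchange (S := ∅) (by simpa using hB) hP (by simp) hPi
  obtain ⟨c, hc', h2⟩ := exists_exchange h1 hQ (by simpa using hQi) hQj
  obtain ⟨d, hd, h3⟩ := exists_exchange h2 hR (by simpa using ⟨hRj, hRi⟩) hRk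
  refine h3 W hW fun e he => ?_
  have hcard : (((B.erase b).erase c).erase d).card = 0 := by
    rw [Finset.card_erase_of_mem hd, Finset.card_erase_of_mem hc', Finset.card_erase_of_mem hb]
    omega
  rw [Finset.card_eq_zero.1 hcard] at he
  simp only [Finset.union_empty, Finset.mem_insert, Finset.notMem_empty, or_false] at he
  rcases he with rfl | rfl | rfl <;> assumption

end OrientedMatroid

/-! ### Restrictions and factorizations -/

namespace OrientedMatroid

variable {α : Type*}

lemma IsStrongMap.trans {M N P : OrientedMatroid α} (h : M.IsStrongMap N) (h' : N.IsStrongMap P) :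
    M.IsStrongMap P :=
  ⟨h.1.trans h'.1, h'.2.trans h.2⟩

variable [DecidableEq α]

/-- The restriction of `M` to the elements of `E`. Elements of `E` outside the ground set of `M`
become loops, so that the ground set is always `E`. -/
def restrict (M : OrientedMatroid α) (E : Finset α) : OrientedMatroid α where
  ground := E
  covectors := {X | ∃ Y ∈ M.covectors, X = fun e => if e ∈ E then Y e else 0}
  supported := by
    rintro _ ⟨Y, -, rfl⟩ e he
    simp [he]
  zero_mem := ⟨0, M.zero_mem, by funext e; simp⟩
  neg_mem := by
    rintro _ ⟨Y, hY, rfl⟩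
    refine ⟨-Y, M.neg_mem Y hY, ?_⟩
    funext e
    by_cases h : e ∈ E <;> simp [h]
  comp_mem := by
    rintro _ ⟨X, hX, rfl⟩ _ ⟨Y, hY, rfl⟩
    refine ⟨X.comp Y, M.comp_mem X hX Y hY, ?_⟩
    funext e
    by_cases h : e ∈ E <;> simp [h, SignedVec.comp]
  elim := by
    rintro _ ⟨X, hX, rfl⟩ _ ⟨Y, hY, rfl⟩ e he
    have heE : e ∈ E := by
      by_contra h
      simp [SignedVec.sep, h] at he
    obtain ⟨Z, hZ, hZe, hZf⟩ := M.elim X hX Y hY e (by simpa [SignedVec.sep, heE] using he)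
    refine ⟨_, ⟨Z, hZ, rfl⟩, by simp [hZe], fun f hf => ?_⟩
    by_cases h : f ∈ E
    · simpa [h, SignedVec.comp] using hZf f (by simpa [SignedVec.sep, h] using hf)
    · simp [h, SignedVec.comp]

lemma restrict_ground (M : OrientedMatroid α) : M.restrict M.ground = M := by
  have key : ∀ Y ∈ M.covectors, (fun e => if e ∈ M.ground then Y e else 0) = Y := fun Y hY => by
    funext e
    by_cases h : e ∈ M.ground
    · simp [h]
    · simp [h, M.supported Y hY e h]
  ext1
  · rfl
  · ext X
    constructor
    · rintro ⟨Y, hY, rfl⟩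
      rwa [key Y hY]
    · exact fun hX => ⟨X, hX, (key X hX).symm⟩

lemma restrict_delete (M : OrientedMatroid α) {E : Finset α} {u : α} (hu : u ∉ E) :
    (M.delete u).restrict E = M.restrict E := by
  have key : ∀ Y : SignedVec α,
      (fun e => if e ∈ E then Y.zeroAt u e else 0) = fun e => if e ∈ E then Y e else 0 := fun Y => by
    funext e
    by_cases h : e ∈ E
    · have : e ≠ u := fun h' => hu (h' ▸ h)
      simp [h, SignedVec.zeroAt, this]
    · simp [h]
  ext1
  · rfl
  · ext X
    constructor
    · rintro ⟨_, ⟨Y, hY, rfl⟩, rfl⟩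
      exact ⟨Y, hY, key Y⟩
    · rintro ⟨Y, hY, rfl⟩
      exact ⟨_, ⟨Y, hY, rfl⟩, (key Y).symm⟩

lemma isStrongMap_restrict_contract (M : OrientedMatroid α) (E : Finset α) (u : α) :
    (M.restrict E).IsStrongMap ((M.contract u).restrict E) :=
  ⟨rfl, fun _ ⟨Y, hY, h⟩ => ⟨Y, hY.1, h⟩⟩

/-- Contracting one element lowers the rank of a restriction by at most one: if some covector
vanishes on a spanning set `B` of the contraction but not on `E`, then any element of its support
completes `B` to a spanning set. -/
lemma rank_restrict_le_contract (M : OrientedMatroid α) (E : Finset α) (u : α) :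
    (M.restrict E).rank ≤ ((M.contract u).restrict E).rank + 1 := by
  obtain ⟨B, hBE, hBc, hB⟩ := ((M.contract u).restrict E).exists_spans_card_eq_rank
  have hB' : ∀ Z ∈ M.covectors, Z u = 0 → (∀ e ∈ B, Z e = 0) → ∀ e ∈ E, Z e = 0 := by
    intro Z hZ hZu hZB e he
    have := hB _ ⟨Z, ⟨hZ, hZu⟩, rfl⟩ fun e he => by simp [hZB e he]
    simpa [he] using congrFun this e
  rw [← hBc]
  by_cases h : (M.restrict E).Spans B
  · exact (rank_le_card (M := M.restrict E) hBE h).trans (Nat.le_succ _)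
  simp only [Spans, not_forall] at h
  obtain ⟨_, ⟨X, hX, rfl⟩, hXB, hX0⟩ := h
  have hXB' : ∀ e ∈ B, X e = 0 := fun e he => by simpa [show e ∈ E from hBE he] using hXB e he
  obtain ⟨e, heE, hXe⟩ : ∃ e ∈ E, X e ≠ 0 := by
    by_contra! hc
    exact hX0 (by funext e; by_cases he : e ∈ E <;> simp [he, hc])
  have hXu : X u ≠ 0 := fun hXu => hXe (hB' X hX hXu hXB' e heE)
  refine (rank_le_card (M := M.restrict E) (B := insert e B) (Finset.insert_subset heE hBE) ?_).trans
    (Finset.card_insert_le _ _)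
  rintro _ ⟨Y, hY, rfl⟩ hYB
  have hY0 : ∀ f ∈ insert e B, Y f = 0 := fun f hf => by
    simpa [show f ∈ E from Finset.insert_subset heE hBE hf] using hYB f hf
  have hYu : Y u = 0 := by
    by_contra hYu
    obtain ⟨Z, hZ, hZu, hZf⟩ := exists_elim_of_ne_zero hX hY hXu hYu
    refine hXe ?_
    rw [← hZf e (hY0 e (by simp))]
    exact hB' Z hZ hZu (fun f hf => by
      rw [hZf f (hY0 f (by simp [hf])), hXB' f hf]) e heE
  funext f
  by_cases hf : f ∈ E
  · simpa [hf] using hB' Y hY hYu (fun g hg => hY0 g (by simp [hg])) f hf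
  · simp [hf]

/-- Along a sequence of extensions and contractions, the restrictions to the original ground set
lose at most one rank in each step, so that every intermediate rank occurs. -/
lemma exists_rank_eq_of_reflTransGen {E : Finset α} {N M₂ : OrientedMatroid α}
    (hE : M₂.ground = E) {k : ℕ} (hk₂ : M₂.rank ≤ k)
    (h : Relation.ReflTransGen (fun M N : OrientedMatroid α =>
      M.IsSingleExtension N ∨ ∃ u ∈ M.ground, u ∉ E ∧ N = M.contract u) N M₂) :
    E ⊆ N.ground → (N.restrict E).IsStrongMap M₂ ∧ (k ≤ (N.restrict E).rank →
      ∃ M' : OrientedMatroid α, M'.rank = k ∧ (N.restrict E).IsStrongMap M' ∧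
        M'.IsStrongMap M₂) := by
  induction h using Relation.ReflTransGen.head_induction_on with
  | refl =>
    intro _
    have : M₂.restrict E = M₂ := by rw [← hE, restrict_ground]
    rw [this]
    exact ⟨⟨rfl, subset_rfl⟩, fun hk => ⟨M₂, le_antisymm hk₂ hk, ⟨rfl, subset_rfl⟩, rfl, subset_rfl⟩⟩
  | @head N N' hstep _ ih =>
    intro hN
    obtain ⟨u, hu, hNu, -, hdel⟩ | ⟨u, -, hu, rfl⟩ := hstep
    · have hr : N.restrict E = N'.restrict E := by
        rw [← hdel, restrict_delete _ fun h => hu (hN h)]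
      rw [hr]
      exact ih (hNu ▸ hN.trans (Finset.subset_insert _ _))
    · obtain ⟨ih₁, ih₂⟩ := ih fun e he => Finset.mem_erase.2 ⟨fun h => hu (h ▸ he), hN he⟩
      have hs := N.isStrongMap_restrict_contract E u
      refine ⟨hs.trans ih₁, fun hk => ?_⟩
      rcases hk.eq_or_lt with hk | hk
      · exact ⟨_, hk.symm, ⟨rfl, subset_rfl⟩, hs.trans ih₁⟩
      · have hd := N.rank_restrict_le_contract E u
        obtain ⟨M', hM', h₁', h₂'⟩ := ih₂ (by omega)
        exact ⟨M', hM', hs.trans h₁', h₂'⟩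

lemma IsFactorizable.exists_rank_eq [Infinite α] {M₁ M₂ : OrientedMatroid α}
    (h : M₁.IsFactorizable M₂) {k : ℕ} (h₁ : k ≤ M₁.rank) (h₂ : M₂.rank ≤ k) :
    ∃ M' : OrientedMatroid α, M'.rank = k ∧ M₁.IsStrongMap M' ∧ M'.IsStrongMap M₂ := by
  have key := (exists_rank_eq_of_reflTransGen h.1.symm h₂ h.2 subset_rfl).2
  rw [restrict_ground] at key
  exact key h₁

end OrientedMatroid

/-! ### The configuration on six elements -/

set_option synthInstance.maxSize 1000 in
/-- A vector with entries `b₁, b₂, b₃, b₅` and zeros at `0` and `4` that has at most three sign changes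
is `(0, -, -, -, 0, +)` up to sign and up to zeros at `1` and `5`, unless its entries at `1` and `5`
are equal and nonzero. -/
lemma sign_pattern : ∀ b₁ b₂ b₃ b₅ : SignType, ¬(b₁ = b₅ ∧ b₁ ≠ 0) →
    ¬(b₁ = 0 ∧ b₂ = 0 ∧ b₃ = 0 ∧ b₅ = 0) →
    (b₁ ≤ 0 → 0 ≤ b₂ → b₃ ≤ 0 → b₁ = 0 ∧ b₂ = 0 ∧ b₃ = 0) →
    (0 ≤ b₁ → b₂ ≤ 0 → 0 ≤ b₃ → b₁ = 0 ∧ b₂ = 0 ∧ b₃ = 0) →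
    (b₁ ≤ 0 → 0 ≤ b₂ → 0 ≤ b₅ → b₁ = 0 ∧ b₂ = 0 ∧ b₅ = 0) →
    (0 ≤ b₁ → b₂ ≤ 0 → b₅ ≤ 0 → b₁ = 0 ∧ b₂ = 0 ∧ b₅ = 0) →
    (b₁ ≤ 0 → 0 ≤ b₃ → 0 ≤ b₅ → b₁ = 0 ∧ b₃ = 0 ∧ b₅ = 0) →
    (0 ≤ b₁ → b₃ ≤ 0 → b₅ ≤ 0 → b₁ = 0 ∧ b₃ = 0 ∧ b₅ = 0) →
    (b₁ ≤ 0 ∧ b₂ = -1 ∧ b₃ = -1 ∧ 0 ≤ b₅) ∨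
    (-b₁ ≤ 0 ∧ -b₂ = -1 ∧ -b₃ = -1 ∧ 0 ≤ -b₅) := by
  decide

/-- A family of sign vectors on six elements, in the position of the covectors of an oriented
matroid of rank three that lies between the alternating oriented matroid of rank four (`alt`) and
the rank two oriented matroid of the sequence `1, 0, 3, 2, 5, 4`, of which three cocircuits are
listed. The last field says that, if `0` is not in the closure of `3` and `4`, the three elements
span. -/
structure SixFrame (S : Set (SignedVec (Fin 6))) : Prop where
  neg_mem : ∀ X ∈ S, -X ∈ S
  elim : ∀ X ∈ S, ∀ Y ∈ S, ∀ e ∈ X.sep Y, ∃ Z ∈ S, Z e = 0 ∧ ∀ f, f ∉ X.sep Y → Z f = X.comp Y f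
  alt : ∀ X ∈ S, ∀ a b c d e, a < b → b < c → c < d → d < e →
    0 ≤ X a → X b ≤ 0 → 0 ≤ X c → X d ≤ 0 → 0 ≤ X e →
    X a = 0 ∧ X b = 0 ∧ X c = 0 ∧ X d = 0 ∧ X e = 0
  mem₀ : ![0, -1, 1, 1, 1, 1] ∈ S
  mem₃ : ![-1, -1, 1, 0, 1, 1] ∈ S
  mem₄ : ![-1, -1, -1, -1, 0, -1] ∈ S
  eq_zero : ∀ Z ∈ S, Z 3 = 0 → Z 4 = 0 → Z 0 ≠ 0 →
    ∀ W ∈ S, W 3 = 0 → W 4 = 0 → W 0 = 0 → W = 0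

namespace SixFrame

variable {S : Set (SignedVec (Fin 6))}

lemma exists_elim (hS : SixFrame S) {X Y : SignedVec (Fin 6)} (hX : X ∈ S) (hY : Y ∈ S) (e : Fin 6)
    (he : X e = -Y e) (he0 : X e ≠ 0) : ∃ Z ∈ S, Z e = 0 ∧
      ∀ f, ¬(X f = -Y f ∧ X f ≠ 0) → Z f = if X f ≠ 0 then X f else Y f :=
  hS.elim X hX Y hY e ⟨he, he0⟩

/-- The heart of the argument. If the sign vector `B` of the line through `0` and `4` did not have
equal signs at `1` and `5`, it would be `(0, -, -, -, 0, +)`, up to zeros at `1` and `5`. Then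
elimination with the three cocircuits gives first the line through `0` and `3`, and from both lines
two vectors that vanish at `3` and `4`. These have to agree, and the common vector
`(+, ?, -, 0, 0, +)` has too many sign changes. -/
theorem eq_and_ne_zero (hS : SixFrame S) {B : SignedVec (Fin 6)} (hB : B ∈ S) (hB0 : B ≠ 0)
    (h0 : B 0 = 0) (h4 : B 4 = 0) : B 1 = B 5 ∧ B 1 ≠ 0 := by
  by_contra hcon
  -- The shape of `B`, from the bound on sign changes.
  obtain ⟨B, hB, h0, h4, h1, h2, h3, h5⟩ : ∃ B ∈ S, B 0 = 0 ∧ B 4 = 0 ∧ B 1 ≤ 0 ∧ B 2 = -1 ∧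
      B 3 = -1 ∧ 0 ≤ B 5 := by
    have alt₀₄ : ∀ C ∈ S, C 0 = 0 → C 4 = 0 →
        (C 1 ≤ 0 → 0 ≤ C 2 → C 3 ≤ 0 → C 1 = 0 ∧ C 2 = 0 ∧ C 3 = 0) ∧
        (C 1 ≤ 0 → 0 ≤ C 2 → 0 ≤ C 5 → C 1 = 0 ∧ C 2 = 0 ∧ C 5 = 0) ∧
        (C 1 ≤ 0 → 0 ≤ C 3 → 0 ≤ C 5 → C 1 = 0 ∧ C 3 = 0 ∧ C 5 = 0) := by
      intro C hC h0 h4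
      refine ⟨fun h1 h2 h3 => ?_, fun h1 h2 h5 => ?_, fun h1 h3 h5 => ?_⟩
      · obtain ⟨-, h1, h2, h3, -⟩ := hS.alt C hC 0 1 2 3 4 (by decide) (by decide) (by decide)
          (by decide) h0.ge h1 h2 h3 h4.ge
        exact ⟨h1, h2, h3⟩
      · obtain ⟨-, h1, h2, -, h5⟩ := hS.alt C hC 0 1 2 4 5 (by decide) (by decide) (by decide)
          (by decide) h0.ge h1 h2 h4.le h5
        exact ⟨h1, h2, h5⟩
      · obtain ⟨-, h1, h3, -, h5⟩ := hS.alt C hC 0 1 3 4 5 (by decide) (by decide) (by decide)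
          (by decide) h0.ge h1 h3 h4.le h5
        exact ⟨h1, h3, h5⟩
    obtain ⟨p₁, p₂, p₃⟩ := alt₀₄ B hB h0 h4
    obtain ⟨n₁, n₂, n₃⟩ := alt₀₄ (-B) (hS.neg_mem B hB) (by simp [h0]) (by simp [h4])
    have hneg : ∀ s : SignType, (0 ≤ -s ↔ s ≤ 0) ∧ (-s ≤ 0 ↔ 0 ≤ s) ∧ (-s = 0 ↔ s = 0) := by decide
    simp only [Pi.neg_apply, hneg] at n₁ n₂ n₃
    have hne : ¬(B 1 = 0 ∧ B 2 = 0 ∧ B 3 = 0 ∧ B 5 = 0) := by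
      rintro ⟨h1, h2, h3, h5⟩
      refine hB0 ?_
      funext e
      fin_cases e <;> assumption
    rcases sign_pattern (B 1) (B 2) (B 3) (B 5) hcon hne p₁ n₁ p₂ n₂ p₃ n₃ with h | h
    · exact ⟨B, hB, h0, h4, h⟩
    · exact ⟨-B, hS.neg_mem B hB, by simp [h0], by simp [h4], h⟩
  have hle : ∀ s : SignType, (s ≤ 0 ↔ s = -1 ∨ s = 0) ∧ (0 ≤ s ↔ s = 1 ∨ s = 0) := by decide
  obtain ⟨A, hA, hA3, hAf⟩ := hS.exists_elim hB hS.mem₀ 3 (by simp [h3]) (by simp [h3])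
  have hA0 : A 0 = 0 := by rw [hAf 0 (by simp [h0])]; simp [h0]
  have hA1 : A 1 = -1 := by
    rw [hAf 1 (by rcases (hle _).1.1 h1 with h | h <;> simp [h])]
    rcases (hle _).1.1 h1 with h | h <;> simp [h]
  have hA4 : A 4 = 1 := by rw [hAf 4 (by simp [h4])]; simp [h4]
  have hA2 : A 2 = -1 := by
    have h := hS.alt A hA 0 1 2 3 4 (by decide) (by decide) (by decide) (by decide)
    rw [hA0, hA1, hA3, hA4] at h
    revert h
    generalize A 2 = x
    revert x
    decide
  obtain ⟨Z, hZ, hZ4, hZf⟩ := hS.exists_elim hA (hS.neg_mem _ hS.mem₃) 4 (by simp [hA4])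
    (by simp [hA4])
  have hZ0 : Z 0 = 1 := by rw [hZf 0 (by simp [hA0])]; simp [hA0]
  have hZ2 : Z 2 = -1 := by rw [hZf 2 (by simp [hA2])]; simp [hA2]
  have hZ3 : Z 3 = 0 := by rw [hZf 3 (by simp [hA3])]; simp [hA3]
  obtain ⟨W, hW, hW3, hWf⟩ := hS.exists_elim hB (hS.neg_mem _ hS.mem₄) 3 (by simp [h3])
    (by simp [h3])
  have hW0 : W 0 = 1 := by rw [hWf 0 (by simp [h0])]; simp [h0]
  have hW4 : W 4 = 0 := by rw [hWf 4 (by simp [h4])]; simp [h4]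
  have hW5 : W 5 = 1 := by
    rw [hWf 5 (by rcases (hle _).2.1 h5 with h | h <;> simp [h])]
    rcases (hle _).2.1 h5 with h | h <;> simp [h]
  -- The sign changes force `Z 5 = -1`, so that elimination of `0` between `Z` and `-W` leaves a
  -- vector that is negative at `5` and vanishes at `0`, `3` and `4`.
  have hZ5 : Z 5 = -1 := by
    have h := hS.alt Z hZ 0 2 3 4 5 (by decide) (by decide) (by decide) (by decide)
    rw [hZ0, hZ2, hZ3, hZ4] at h
    revert h
    generalize Z 5 = x
    revert x
    decide
  obtain ⟨U, hU, hU0, hUf⟩ := hS.exists_elim hZ (hS.neg_mem _ hW) 0 (by simp [hZ0, hW0])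
    (by simp [hZ0])
  have hU3 : U 3 = 0 := by rw [hUf 3 (by simp [hZ3])]; simp [hZ3, hW3]
  have hU4 : U 4 = 0 := by rw [hUf 4 (by simp [hZ4])]; simp [hZ4, hW4]
  have hU5 : U 5 = -1 := by rw [hUf 5 (by simp [hZ5, hW5])]; simp [hZ5]
  have := hS.eq_zero Z hZ hZ3 hZ4 (by simp [hZ0]) U hU hU3 hU4 hU0
  simp [this] at hU5

end SixFrame

/-! ### Oriented matroids of polynomials of bounded degree -/

/-- The signs of two numbers determine the sign of a positive combination, unless they are
opposite. -/
lemma sign_pos_combination {a b x y : ℝ} (ha : 0 < a) (hb : 0 < b)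
    (h : ¬(SignType.sign x = -SignType.sign y ∧ SignType.sign x ≠ 0)) :
    SignType.sign (a * x + b * y) =
      if SignType.sign x ≠ 0 then SignType.sign x else SignType.sign y := by
  rcases lt_trichotomy x 0 with hx | rfl | hx <;> rcases lt_trichotomy y 0 with hy | rfl | hy
  · rw [sign_neg (by nlinarith [mul_pos ha (neg_pos.2 hx), mul_pos hb (neg_pos.2 hy)])]
    simp [hx]
  · simp [sign_mul, ha]
  · simp [sign_neg hx, sign_pos hy] at h
  · simp [sign_mul, hb]
  · simp
  · simp [sign_mul, hb]
  · simp [sign_neg hy, sign_pos hx] at h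
  · simp [sign_mul, ha]
  · rw [sign_pos (by positivity)]
    simp [hx]

open Polynomial

namespace OrientedMatroid

variable {α : Type*}

variable [DecidableEq α]

/-- The signs of a polynomial `p` at the points `s e`, for `e ∈ E`. -/
noncomputable def signVec (E : Finset α) (s : α → ℝ) (p : ℝ[X]) : SignedVec α :=
  fun e => if e ∈ E then SignType.sign (p.eval (s e)) else 0

lemma signVec_of_mem {E : Finset α} {e : α} (he : e ∈ E) (s : α → ℝ) (p : ℝ[X]) :
    signVec E s p e = SignType.sign (p.eval (s e)) := by
  simp [signVec, he]

lemma signVec_of_notMem {E : Finset α} {e : α} (he : e ∉ E) (s : α → ℝ) (p : ℝ[X]) :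
    signVec E s p e = 0 := by
  simp [signVec, he]

lemma signVec_neg (E : Finset α) (s : α → ℝ) (p : ℝ[X]) : signVec E s (-p) = -signVec E s p := by
  funext e
  by_cases he : e ∈ E <;> simp [signVec, he, Left.sign_neg]

lemma signVec_ne_zero_iff {E : Finset α} {s : α → ℝ} {p : ℝ[X]} :
    signVec E s p ≠ 0 ↔ ∃ e ∈ E, p.eval (s e) ≠ 0 := by
  constructor
  · intro h
    by_contra! hc
    exact h (by funext e; by_cases he : e ∈ E <;> simp [signVec, he, hc])
  · rintro ⟨e, he, h⟩ h0
    exact h (by simpa [signVec, he] using congrFun h0 e)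

/-- The oriented matroid of the points `s e`, for `e ∈ E`, on the moment curve of degree `r - 1`:
its covectors are the sign vectors of the polynomials of degree less than `r`. -/
noncomputable def polynomialOM (E : Finset α) (s : α → ℝ) (r : ℕ) : OrientedMatroid α where
  ground := E
  covectors := {X | ∃ p ∈ degreeLT ℝ r, X = signVec E s p}
  supported := by
    rintro _ ⟨p, -, rfl⟩ e he
    exact signVec_of_notMem he s p
  zero_mem := ⟨0, Submodule.zero_mem _, by funext e; simp [signVec]⟩
  neg_mem := by
    rintro _ ⟨p, hp, rfl⟩
    exact ⟨-p, Submodule.neg_mem _ hp, (signVec_neg E s p).symm⟩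
  comp_mem := by
    rintro _ ⟨p, hp, rfl⟩ _ ⟨q, hq, rfl⟩
    -- `p + t * q` for a sufficiently small `t > 0`
    have hev : ∀ᶠ t : ℝ in nhdsWithin 0 (Set.Ioi 0), ∀ e ∈ E,
        SignType.sign (p.eval (s e) + t * q.eval (s e)) =
          if SignType.sign (p.eval (s e)) ≠ 0 then SignType.sign (p.eval (s e))
          else SignType.sign (q.eval (s e)) := by
      rw [Filter.eventually_all_finset]
      intro e _
      have hc : Filter.Tendsto (fun t : ℝ => p.eval (s e) + t * q.eval (s e))
          (nhdsWithin 0 (Set.Ioi 0)) (nhds (p.eval (s e))) := by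
        have : Continuous fun t : ℝ => p.eval (s e) + t * q.eval (s e) := by fun_prop
        simpa using (this.tendsto 0).mono_left nhdsWithin_le_nhds
      rcases lt_trichotomy (p.eval (s e)) 0 with h | h | h
      · filter_upwards [hc.eventually (gt_mem_nhds h)] with t ht
        simp [h, ht]
      · filter_upwards [self_mem_nhdsWithin] with t ht
        have ht' : (0 : ℝ) < t := ht
        simp [h, sign_mul, ht']
      · filter_upwards [hc.eventually (lt_mem_nhds h)] with t ht
        simp [h, ht]
    obtain ⟨t, ht⟩ := hev.exists
    refine ⟨p + t • q, add_mem hp (Submodule.smul_mem _ t hq), ?_⟩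
    funext e
    by_cases he : e ∈ E
    · simpa [SignedVec.comp, signVec, he] using (ht e he).symm
    · simp [SignedVec.comp, signVec, he]
  elim := by
    rintro _ ⟨p, hp, rfl⟩ _ ⟨q, hq, rfl⟩ e ⟨he, he0⟩
    have heE : e ∈ E := by
      by_contra h
      exact he0 (signVec_of_notMem h s p)
    simp only [signVec_of_mem heE] at he he0
    have hp0 : p.eval (s e) ≠ 0 := by simpa using he0
    have hq0 : q.eval (s e) ≠ 0 := by
      intro h
      simp [h] at he
      exact hp0 he
    refine ⟨_, ⟨|q.eval (s e)| • p + |p.eval (s e)| • q,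
      add_mem (Submodule.smul_mem _ _ hp) (Submodule.smul_mem _ _ hq), rfl⟩, ?_, fun f hf => ?_⟩
    · rw [signVec_of_mem heE, sign_eq_zero_iff]
      simp only [eval_add, eval_smul, smul_eq_mul]
      rcases hp0.lt_or_gt with h | h <;> rcases hq0.lt_or_gt with h' | h'
      · simp [sign_neg h, sign_neg h'] at he
      · rw [abs_of_neg h, abs_of_pos h']; ring
      · rw [abs_of_pos h, abs_of_neg h']; ring
      · simp [sign_pos h, sign_pos h'] at he
    · by_cases hfE : f ∈ E
      · have := sign_pos_combination (abs_pos.2 hq0) (abs_pos.2 hp0)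
          (x := p.eval (s f)) (y := q.eval (s f))
          (by simpa [SignedVec.sep, signVec_of_mem hfE] using hf)
        simpa [SignedVec.comp, signVec_of_mem hfE] using this
      · simp [SignedVec.comp, signVec_of_notMem hfE]

end OrientedMatroid

namespace OrientedMatroid

variable {α : Type*} {E : Finset α} {s : α → ℝ} {r m : ℕ}

/-- A polynomial of degree less than `r` with `r` zeros vanishes. -/
lemma eq_zero_of_mem_degreeLT (hs : Set.InjOn s E) {p : ℝ[X]} (hp : p ∈ degreeLT ℝ r)
    {Z : Finset α} (hZ : Z ⊆ E) (hc : r ≤ Z.card) (h : ∀ z ∈ Z, p.eval (s z) = 0) : p = 0 :=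
  eq_zero_of_degree_lt_of_eval_index_eq_zero Z (hs.mono (by exact_mod_cast hZ))
    ((mem_degreeLT.1 hp).trans_le (by exact_mod_cast hc)) h

lemma nodal_mem_degreeLT {Z : Finset α} (hc : Z.card < r) :
    Lagrange.nodal Z s ∈ degreeLT ℝ r := by
  rw [mem_degreeLT, Lagrange.degree_nodal]
  exact_mod_cast hc

lemma eval_nodal_eq_zero_iff (hs : Set.InjOn s E) {Z : Finset α} (hZ : Z ⊆ E) {e : α}
    (he : e ∈ E) : (Lagrange.nodal Z s).eval (s e) = 0 ↔ e ∈ Z := by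
  rw [Lagrange.eval_nodal, Finset.prod_eq_zero_iff]
  constructor
  · rintro ⟨z, hz, h⟩
    rwa [hs he (hZ hz) (sub_eq_zero.1 h)]
  · exact fun h => ⟨e, h, sub_self _⟩

variable [DecidableEq α]

lemma rank_polynomialOM (hs : Set.InjOn s E) (hr : r ≤ E.card) :
    (polynomialOM E s r).rank = r := by
  refine le_antisymm ?_ ?_
  · obtain ⟨B, hB, rfl⟩ := Finset.exists_subset_card_eq hr
    refine rank_le_card (M := polynomialOM E s B.card) hB ?_
    rintro _ ⟨p, hp, rfl⟩ h
    rw [eq_zero_of_mem_degreeLT hs hp hB le_rfl fun z hz => by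
      simpa [signVec_of_mem (hB hz)] using h z hz]
    funext e
    simp [signVec]
  · obtain ⟨B, hB, hc, hsp⟩ := (polynomialOM E s r).exists_spans_card_eq_rank
    by_contra! hlt
    rw [← hc] at hlt
    obtain ⟨e, he, heB⟩ := Finset.exists_mem_notMem_of_card_lt_card (hlt.trans_le hr)
    have := congrFun (hsp _ ⟨_, nodal_mem_degreeLT hlt, rfl⟩ fun e he => by
      rw [signVec_of_mem (show e ∈ E from hB he), Lagrange.eval_nodal_at_node he, sign_zero]) e
    rw [signVec_of_mem he, Pi.zero_apply, sign_eq_zero_iff, eval_nodal_eq_zero_iff hs hB he] at this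
    exact heB this

/-- Two polynomials of degree at most `m` with the same `m` zeros are proportional. -/
lemma signVec_eq_or_eq_neg (hs : Set.InjOn s E) {p q : ℝ[X]} (hp : p ∈ degreeLT ℝ (m + 1))
    (hq : q ∈ degreeLT ℝ (m + 1)) {Z : Finset α} (hZ : Z ⊆ E) (hc : Z.card = m)
    (hpZ : ∀ z ∈ Z, p.eval (s z) = 0) (hqZ : ∀ z ∈ Z, q.eval (s z) = 0)
    (hp0 : signVec E s p ≠ 0) (hq0 : signVec E s q ≠ 0) :
    signVec E s q = signVec E s p ∨ signVec E s q = -signVec E s p := by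
  obtain ⟨e₀, he₀, hpe₀⟩ := signVec_ne_zero_iff.1 hp0
  have he₀Z : e₀ ∉ Z := fun h => hpe₀ (hpZ e₀ h)
  have h0 : q.eval (s e₀) • p - p.eval (s e₀) • q = 0 := by
    refine eq_zero_of_mem_degreeLT hs (r := m + 1) (Z := insert e₀ Z)
      (Submodule.sub_mem _ (Submodule.smul_mem _ _ hp) (Submodule.smul_mem _ _ hq))
      (Finset.insert_subset he₀ hZ) (by rw [Finset.card_insert_of_notMem he₀Z, hc]) fun z hz => ?_
    rcases Finset.mem_insert.1 hz with rfl | hz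
    · simp [mul_comm]
    · simp [hpZ z hz, hqZ z hz]
  set c := q.eval (s e₀) / p.eval (s e₀) with hcdef
  have hqc : ∀ e, q.eval (s e) = c * p.eval (s e) := fun e => by
    have := congrArg (eval (s e)) h0
    simp only [eval_sub, eval_smul, smul_eq_mul, eval_zero] at this
    rw [hcdef]
    field_simp
    linarith
  have hc0 : c ≠ 0 := by
    intro hc0
    obtain ⟨e, -, he⟩ := signVec_ne_zero_iff.1 hq0
    exact he (by rw [hqc, hc0, zero_mul])
  rcases hc0.lt_or_gt with h | h
  · right
    funext e
    by_cases he : e ∈ E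
    · simp [signVec_of_mem he, hqc, sign_mul, h]
    · simp [signVec_of_notMem he]
  · left
    funext e
    by_cases he : e ∈ E
    · simp [signVec_of_mem he, hqc, sign_mul, h]
    · simp [signVec_of_notMem he]

lemma isCocircuit_signVec (hs : Set.InjOn s E) {p : ℝ[X]} (hp : p ∈ degreeLT ℝ (m + 1))
    {Z : Finset α} (hZ : Z ⊆ E) (hc : Z.card = m) (hpZ : ∀ z ∈ Z, p.eval (s z) = 0)
    (hp0 : signVec E s p ≠ 0) : (polynomialOM E s (m + 1)).IsCocircuit (signVec E s p) := by
  refine ⟨⟨p, hp, rfl⟩, hp0, ?_⟩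
  rintro _ ⟨q, hq, rfl⟩ hq0 hconf
  have hqZ : ∀ z ∈ Z, q.eval (s z) = 0 := by
    intro z hz
    by_contra h
    have := hconf z (by simpa [signVec_of_mem (hZ hz)] using h)
    rw [signVec_of_mem (hZ hz), signVec_of_mem (hZ hz), hpZ z hz, sign_zero] at this
    exact h (sign_eq_zero_iff.1 this.symm)
  rcases signVec_eq_or_eq_neg hs hp hq hZ hc hpZ hqZ hp0 hq0 with h | h
  · exact h
  · obtain ⟨e, he⟩ := Function.ne_iff.1 hq0
    have h1 := hconf e he
    exfalso
    rw [h, Pi.neg_apply, Pi.zero_apply] at he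
    rw [h, Pi.neg_apply] at h1
    revert h1 he
    generalize signVec E s p e = x
    revert x
    decide

/-- The polynomial of a cocircuit has `m` zeros. With fewer zeros, there is a polynomial `q` with
one zero `e₁` more, and subtracting from `p` the multiple of `q` that is the first to produce a new
zero `e₀` gives a smaller nonzero covector. -/
lemma IsCocircuit.exists_zeros (hs : Set.InjOn s E) (hm : m < E.card) {Y : SignedVec α}
    (hY : (polynomialOM E s (m + 1)).IsCocircuit Y) :
    ∃ p ∈ degreeLT ℝ (m + 1), Y = signVec E s p ∧
      ∃ Z ⊆ E, Z.card = m ∧ ∀ z ∈ Z, p.eval (s z) = 0 := by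
  obtain ⟨⟨p, hp, rfl⟩, hp0, hmin⟩ := hY
  refine ⟨p, hp, rfl, ?_⟩
  set Z := E.filter fun e => p.eval (s e) = 0 with hZdef
  have hZE : Z ⊆ E := Finset.filter_subset _ _
  have hZ : ∀ e ∈ E, (e ∈ Z ↔ p.eval (s e) = 0) := fun e he => by simp [hZdef, he]
  by_contra! hcon
  have hlt : Z.card < m := by
    by_contra! hle
    obtain ⟨Z', hZ', hc'⟩ := Finset.exists_subset_card_eq hle
    obtain ⟨z, hz, hz0⟩ := hcon Z' (hZ'.trans hZE) hc'
    exact hz0 ((hZ z (hZE (hZ' hz))).1 (hZ' hz))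
  obtain ⟨e₁, he₁, hpe₁⟩ := signVec_ne_zero_iff.1 hp0
  have he₁Z : e₁ ∉ Z := fun h => hpe₁ ((hZ e₁ he₁).1 h)
  have hZ₁E : insert e₁ Z ⊆ E := Finset.insert_subset he₁ hZE
  have hc₁ : (insert e₁ Z).card = Z.card + 1 := Finset.card_insert_of_notMem he₁Z
  set q := Lagrange.nodal (insert e₁ Z) s with hqdef
  have hq : q ∈ degreeLT ℝ (m + 1) := nodal_mem_degreeLT (by omega)
  obtain ⟨e₂, he₂, he₂Z⟩ := Finset.exists_mem_notMem_of_card_lt_card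
    (show (insert e₁ Z).card < E.card by omega)
  have hqe₂ : q.eval (s e₂) ≠ 0 := fun h => he₂Z ((eval_nodal_eq_zero_iff hs hZ₁E he₂).1 h)
  have hpe₂ : p.eval (s e₂) ≠ 0 := fun h =>
    he₂Z (Finset.mem_insert_of_mem ((hZ e₂ he₂).2 h))
  obtain ⟨e₀, he₀, hmax⟩ := Finset.exists_max_image (E \ Z)
    (fun e => |q.eval (s e) / p.eval (s e)|) ⟨e₁, by simp [he₁, he₁Z]⟩
  obtain ⟨he₀E, he₀Z⟩ := Finset.mem_sdiff.1 he₀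
  have hpe₀ : p.eval (s e₀) ≠ 0 := fun h => he₀Z ((hZ e₀ he₀E).2 h)
  have hqe₀ : q.eval (s e₀) ≠ 0 := by
    intro h
    have := hmax e₂ (by
      rw [Finset.mem_sdiff]
      exact ⟨he₂, fun h => he₂Z (Finset.mem_insert_of_mem h)⟩)
    rw [h, zero_div, abs_zero] at this
    exact (abs_pos.2 (div_ne_zero hqe₂ hpe₂)).not_ge this
  set c := p.eval (s e₀) / q.eval (s e₀) with hcdef
  have hbound : ∀ e ∈ E, |c * q.eval (s e)| ≤ |p.eval (s e)| := by
    intro e he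
    by_cases hpe : p.eval (s e) = 0
    · have : q.eval (s e) = 0 :=
        (eval_nodal_eq_zero_iff hs hZ₁E he).2 (Finset.mem_insert_of_mem ((hZ e he).2 hpe))
      simp [this]
    · have h := hmax e (Finset.mem_sdiff.2 ⟨he, fun h => hpe ((hZ e he).1 h)⟩)
      rw [abs_div, abs_div, div_le_div_iff₀ (abs_pos.2 hpe) (abs_pos.2 hpe₀)] at h
      rw [hcdef, abs_mul, abs_div, div_mul_eq_mul_div, div_le_iff₀ (abs_pos.2 hqe₀)]
      linarith
  have hh : p - c • q ∈ degreeLT ℝ (m + 1) := Submodule.sub_mem _ hp (Submodule.smul_mem _ _ hq)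
  have hqe₁ : q.eval (s e₁) = 0 := Lagrange.eval_nodal_at_node (by simp)
  have heq := hmin _ ⟨_, hh, rfl⟩ (signVec_ne_zero_iff.2 ⟨e₁, he₁, by simpa [hqe₁] using hpe₁⟩)
    (by
      intro e he
      by_cases heE : e ∈ E
      · rw [signVec_of_mem heE, signVec_of_mem heE]
        rw [signVec_of_mem heE] at he
        have he' := sign_ne_zero.1 he
        simp only [eval_sub, eval_smul, smul_eq_mul] at he' ⊢
        have hb := hbound e heE
        rcases lt_trichotomy (p.eval (s e)) 0 with h | h | h
        · rw [abs_of_neg h, abs_le] at hb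
          rw [sign_neg h, sign_neg (lt_of_le_of_ne (by linarith [hb.1]) he')]
        · rw [h, abs_zero, abs_nonpos_iff] at hb
          rw [h, hb, sub_zero] at he'
          exact absurd rfl he'
        · rw [abs_of_pos h, abs_le] at hb
          rw [sign_pos h, sign_pos (lt_of_le_of_ne (by linarith [hb.2]) he'.symm)]
      · exact absurd (signVec_of_notMem heE s _) he)
  have := congrFun heq e₀
  rw [signVec_of_mem he₀E, signVec_of_mem he₀E] at this
  have h0 : (p - c • q).eval (s e₀) = 0 := by
    simp [hcdef, hqe₀]
  rw [h0, sign_zero] at this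
  exact hpe₀ (sign_eq_zero_iff.1 this.symm)

/-- The sign of the Vandermonde determinant of the points `s (x i)`, set to zero for tuples that
leave `E`. -/
noncomputable def vandermondeSign (E : Finset α) (s : α → ℝ) (r : ℕ) (x : Fin r → α) : SignType :=
  if ∀ i, x i ∈ E then SignType.sign (Matrix.vandermonde (s ∘ x)).det else 0

lemma vandermondeSign_ne_zero_iff (hs : Set.InjOn s E) {x : Fin r → α} :
    vandermondeSign E s r x ≠ 0 ↔ (∀ i, x i ∈ E) ∧ Function.Injective x := by
  unfold vandermondeSign
  split_ifs with h
  · rw [sign_ne_zero, Matrix.det_vandermonde_ne_zero_iff]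
    refine ⟨fun h' => ⟨h, h'.of_comp⟩, fun h' i j hij => h'.2 (hs (h i) (h j) hij)⟩
  · simp [h]

/-- As a function of one of its points, the Vandermonde determinant is a polynomial. -/
lemma exists_vandermondeSign_update (x : Fin r → α) (i : Fin r) (hx : ∀ k, k ≠ i → x k ∈ E) :
    ∃ p ∈ degreeLT ℝ r, (fun e => vandermondeSign E s r (Function.update x i e)) =
      signVec E s p := by
  set V := Matrix.vandermonde (s ∘ x) with hV
  refine ⟨∑ j : Fin r, (V.adjugate j i) • X ^ (j : ℕ), Submodule.sum_mem _ fun j _ =>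
    Submodule.smul_mem _ _ (mem_degreeLT.2 ?_), ?_⟩
  · rw [degree_X_pow]
    exact_mod_cast j.2
  · have hdet : ∀ e, (Matrix.vandermonde (s ∘ Function.update x i e)).det =
        eval (s e) (∑ j : Fin r, (V.adjugate j i) • X ^ (j : ℕ)) := by
      intro e
      have hup : Matrix.vandermonde (s ∘ Function.update x i e) =
          V.updateRow i fun j => s e ^ (j : ℕ) := by
        ext k j
        by_cases hk : k = i
        · subst hk
          simp [Matrix.vandermonde_apply]
        · simp [Matrix.vandermonde_apply, hV, Matrix.updateRow_ne hk, Function.update_of_ne hk]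
      rw [hup, Matrix.det_eq_sum_mul_adjugate_row _ i, eval_finsetSum]
      refine Finset.sum_congr rfl fun j _ => ?_
      simp [Matrix.adjugate_apply, Matrix.updateRow_idem, mul_comm]
    funext e
    by_cases he : e ∈ E
    · have : ∀ k, Function.update x i e k ∈ E := fun k => by
        by_cases hk : k = i
        · subst hk; simpa using he
        · simpa [Function.update_of_ne hk] using hx k hk
      rw [signVec_of_mem he, vandermondeSign, if_pos this, hdet]
    · rw [signVec_of_notMem he, vandermondeSign, if_neg fun h => he (by simpa using h i)]

/-- The signs of the Vandermonde determinants form a chirotope. -/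
theorem isChirotope_vandermondeSign (hs : Set.InjOn s E) (hm : m < E.card) :
    (polynomialOM E s (m + 1)).IsChirotope (vandermondeSign E s (m + 1)) where
  rank_eq := rank_polynomialOM hs hm
  antisymm x i j hij := by
    have hmem : (∀ k, (x ∘ Equiv.swap i j) k ∈ E) ↔ ∀ k, x k ∈ E :=
      ⟨fun h k => by simpa using h (Equiv.swap i j k), fun h k => h _⟩
    have hdet : (Matrix.vandermonde (s ∘ x ∘ Equiv.swap i j)).det =
        -(Matrix.vandermonde (s ∘ x)).det := by
      have := Matrix.det_permute (Equiv.swap i j) (Matrix.vandermonde (s ∘ x))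
      rw [Equiv.Perm.sign_swap hij] at this
      simp only [Units.val_neg, Units.val_one, Int.cast_neg, Int.cast_one, neg_one_mul] at this
      rw [← this]
      rfl
    unfold vandermondeSign
    by_cases h : ∀ k, x k ∈ E
    · rw [if_pos h, if_pos (hmem.2 h), hdet, Left.sign_neg]
    · rw [if_neg h, if_neg (fun h' => h (hmem.1 h')), neg_zero]
  exists_ne_zero := by
    obtain ⟨B, hB, hc⟩ := Finset.exists_subset_card_eq (Nat.succ_le_of_lt hm)
    exact ⟨fun i => (B.equivFinOfCardEq hc).symm i, (vandermondeSign_ne_zero_iff hs).2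
      ⟨fun i => hB (Subtype.coe_prop _),
        Subtype.val_injective.comp (B.equivFinOfCardEq hc).symm.injective⟩⟩
  isCocircuit_iff Y := by
    -- a nonzero signed vector obtained from the Vandermonde determinant has `m` zeros
    have zeros : ∀ (x : Fin (m + 1) → α) (i : Fin (m + 1)),
        (fun e => vandermondeSign E s (m + 1) (Function.update x i e)) ≠ 0 →
        ∃ p ∈ degreeLT ℝ (m + 1),
          (fun e => vandermondeSign E s (m + 1) (Function.update x i e)) = signVec E s p ∧
          (Finset.univ.erase i).image x ⊆ E ∧ ((Finset.univ.erase i).image x).card = m ∧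
          ∀ z ∈ (Finset.univ.erase i).image x, p.eval (s z) = 0 := by
      intro x i hne
      obtain ⟨e, he⟩ := Function.ne_iff.1 hne
      obtain ⟨hE, hinj⟩ := (vandermondeSign_ne_zero_iff hs).1 he
      have hx : ∀ k, k ≠ i → x k ∈ E := fun k hk => by
        simpa [Function.update_of_ne hk] using hE k
      obtain ⟨p, hp, hpeq⟩ := exists_vandermondeSign_update (s := s) x i hx
      have hsub : (Finset.univ.erase i).image x ⊆ E := by
        intro z hz
        obtain ⟨k, hk, rfl⟩ := Finset.mem_image.1 hz
        exact hx k (Finset.ne_of_mem_erase hk)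
      refine ⟨p, hp, hpeq, hsub, ?_, ?_⟩
      · rw [Finset.card_image_of_injOn, Finset.card_erase_of_mem (Finset.mem_univ i)]
        · simp
        · intro k hk l hl hkl
          have hk' : k ≠ i := by simpa using hk
          have hl' : l ≠ i := by simpa using hl
          exact hinj (by simpa [Function.update_of_ne hk', Function.update_of_ne hl'] using hkl)
      · intro z hz
        have h0 := congrFun hpeq z
        rw [signVec_of_mem (hsub hz)] at h0
        obtain ⟨k, hk, rfl⟩ := Finset.mem_image.1 hz
        have hk' : k ≠ i := Finset.ne_of_mem_erase hk
        rw [← sign_eq_zero_iff, ← h0]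
        by_contra h
        exact hk' (((vandermondeSign_ne_zero_iff hs).1 h).2 (by simp [Function.update_of_ne hk']))
    constructor
    · intro hY
      refine ⟨hY.2.1, ?_⟩
      obtain ⟨p, hp, rfl, Z, hZE, hZc, hpZ⟩ := hY.exists_zeros hs hm
      obtain ⟨e₀, he₀, hpe₀⟩ := signVec_ne_zero_iff.1 hY.2.1
      have he₀Z : e₀ ∉ Z := fun h => hpe₀ (hpZ e₀ h)
      let z : Fin m → α := fun i => (Z.equivFinOfCardEq hZc).symm i
      have hz : ∀ i, z i ∈ Z := fun i => Subtype.coe_prop _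
      have hzinj : Function.Injective z :=
        Subtype.val_injective.comp (Z.equivFinOfCardEq hZc).symm.injective
      have hne : (fun e => vandermondeSign E s (m + 1)
          (Function.update (Fin.cons e₀ z : Fin (m + 1) → α) 0 e)) ≠ 0 := by
        refine Function.ne_iff.2 ⟨e₀, (vandermondeSign_ne_zero_iff hs).2 ?_⟩
        rw [Fin.update_cons_zero]
        refine ⟨fun i => Fin.cases he₀ (fun j => hZE (hz j)) i, Fin.cons_injective_iff.2 ⟨?_, hzinj⟩⟩
        rintro ⟨i, hi⟩
        exact he₀Z (hi ▸ hz i)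
      obtain ⟨q, hq, hqeq, hsub, hcard, hqZ⟩ := zeros _ _ hne
      have hZsub : (Finset.univ.erase 0).image (Fin.cons e₀ z : Fin (m + 1) → α) ⊆ Z := by
        intro w hw
        obtain ⟨k, hk, rfl⟩ := Finset.mem_image.1 hw
        obtain ⟨j, rfl⟩ := Fin.exists_succ_eq.2 (Finset.ne_of_mem_erase hk)
        exact hz j
      refine ⟨Fin.cons e₀ z, 0, ?_⟩
      have hfun : (fun e => -vandermondeSign E s (m + 1)
          (Function.update (Fin.cons e₀ z : Fin (m + 1) → α) 0 e)) = -signVec E s q := by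
        rw [← hqeq]; rfl
      rw [hfun, hqeq]
      rw [hqeq] at hne
      exact signVec_eq_or_eq_neg hs hq hp hsub hcard hqZ (fun w hw => hpZ w (hZsub hw)) hne hY.2.1
    · rintro ⟨hY0, x, i, rfl | rfl⟩
      · obtain ⟨p, hp, hpeq, hsub, hcard, hpZ⟩ := zeros x i hY0
        rw [hpeq] at hY0 ⊢
        exact isCocircuit_signVec hs hp hsub hcard hpZ hY0
      · have hY0' : (fun e => vandermondeSign E s (m + 1) (Function.update x i e)) ≠ 0 := by
          intro h
          exact hY0 (by funext e; simpa using congrFun h e)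
        obtain ⟨p, hp, hpeq, hsub, hcard, hpZ⟩ := zeros x i hY0'
        have hfun : (fun e => -vandermondeSign E s (m + 1) (Function.update x i e)) =
            signVec E s (-p) := by
          rw [signVec_neg, ← hpeq]; rfl
        rw [hfun] at hY0 ⊢
        exact isCocircuit_signVec hs (Submodule.neg_mem _ hp) hsub hcard
          (fun z hz => by simp [hpZ z hz]) hY0

end OrientedMatroid

/-! ### The two oriented matroids -/

namespace OrientedMatroid

/-- The alternating oriented matroid of rank four on `{1, …, 8}`. -/
noncomputable def alternating48 : OrientedMatroid ℕ :=
  polynomialOM (Finset.Icc 1 8) (fun e => (e : ℝ)) 4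

/-- The rank two oriented matroid of the permutation `sigma8`. -/
noncomputable def permSigma8 : OrientedMatroid ℕ :=
  polynomialOM (Finset.Icc 1 8) (fun e => -(sigma8 e : ℝ)) 2

lemma injOn_natCast : Set.InjOn (fun e : ℕ => (e : ℝ)) (Finset.Icc 1 8) :=
  Nat.cast_injective.injOn

lemma injOn_neg_sigma8 : Set.InjOn (fun e : ℕ => -(sigma8 e : ℝ)) (Finset.Icc 1 8) :=
  (neg_injective.comp (Nat.cast_injective.comp sigma8.injective)).injOn

lemma rank_alternating48 : alternating48.rank = 4 :=
  rank_polynomialOM injOn_natCast (by simp)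

lemma rank_permSigma8 : permSigma8.rank = 2 :=
  rank_polynomialOM injOn_neg_sigma8 (by simp)

lemma isAlternating_alternating48 : alternating48.IsAlternating 4 8 := by
  refine ⟨rfl, _, isChirotope_vandermondeSign (m := 3) injOn_natCast (by simp), fun x hx hE => ?_⟩
  rw [vandermondeSign, if_pos hE, sign_eq_one_iff, Matrix.det_vandermonde]
  refine Finset.prod_pos fun i _ => Finset.prod_pos fun j hj => ?_
  simpa using hx (Finset.mem_Ioi.1 hj)

lemma isGivenByPerm_permSigma8 : permSigma8.IsGivenByPerm 8 sigma8 := by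
  refine ⟨rfl, _, isChirotope_vandermondeSign (m := 1) injOn_neg_sigma8 (by simp),
    fun i hi j hj _ => ?_⟩
  have hE : ∀ k, ![i, j] k ∈ Finset.Icc 1 8 := by
    intro k
    fin_cases k <;> assumption
  rw [vandermondeSign, if_pos hE, sign_eq_one_iff, Matrix.det_fin_two]
  simp [Matrix.vandermonde_apply]

lemma exists_eval_eq_of_mem_degreeLT_four {p : ℝ[X]} (hp : p ∈ degreeLT ℝ 4) :
    ∃ a b c d : ℝ, ∀ x, p.eval x = a * x ^ 3 + b * x ^ 2 + c * x + d := by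
  refine ⟨p.coeff 3, p.coeff 2, p.coeff 1, p.coeff 0, fun x => ?_⟩
  have h4 : p.natDegree < 4 := by
    by_cases h0 : p = 0
    · simp [h0]
    · exact (natDegree_lt_iff_degree_lt h0).2 (by simpa using mem_degreeLT.1 hp)
  rw [eval_eq_sum_range' h4]
  simp [Finset.sum_range_succ]
  ring

lemma exists_mem_degreeLT_four (a b c d : ℝ) :
    ∃ p ∈ degreeLT ℝ 4, ∀ x, p.eval x = a * x ^ 3 + b * x ^ 2 + c * x + d :=
  ⟨C a * X ^ 3 + C b * X ^ 2 + C c * X + C d,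
    mem_degreeLT.2 (degree_cubic_le.trans_lt (by norm_num)), fun x => by simp⟩

lemma isRealizable_alternating48 : alternating48.IsRealizable := by
  refine ⟨3, fun e => ![(e : ℝ), e ^ 2, e ^ 3], fun _ => 1, ?_, by simp, ?_⟩
  · -- every vector is an affine combination of the first four points
    set p : ℕ → Fin 3 → ℝ := fun e => ![(e : ℝ), e ^ 2, e ^ 3] with hp
    set A := affineSpan ℝ (p '' (Finset.Icc 1 8 : Finset ℕ)) with hA
    have hmem : ∀ e ∈ Finset.Icc 1 8, p e ∈ A := fun e he =>
      subset_affineSpan ℝ _ ⟨e, by exact_mod_cast he, rfl⟩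
    change A = ⊤
    rw [eq_top_iff]
    rintro v -
    have hdir : ∀ e ∈ Finset.Icc 1 8, p e - p 1 ∈ A.direction := fun e he =>
      AffineSubspace.vsub_mem_direction (hmem e he) (hmem 1 (by simp))
    have hv : v = (((v 0 - 1) - (7 * (v 1 - 1) - 14 * (v 0 - 1) - (v 2 - 1))
          - ((v 2 - 1) - 6 * (v 1 - 1) + 11 * (v 0 - 1)) / 2) • (p 2 - p 1)
        + ((7 * (v 1 - 1) - 14 * (v 0 - 1) - (v 2 - 1)) / 2) • (p 3 - p 1)
        + (((v 2 - 1) - 6 * (v 1 - 1) + 11 * (v 0 - 1)) / 6) • (p 4 - p 1)) +ᵥ p 1 := by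
      funext i
      fin_cases i <;> simp [hp] <;> ring
    rw [hv]
    exact AffineSubspace.vadd_mem_of_mem_direction (add_mem (add_mem
      (Submodule.smul_mem _ _ (hdir 2 (by simp))) (Submodule.smul_mem _ _ (hdir 3 (by simp))))
      (Submodule.smul_mem _ _ (hdir 4 (by simp)))) (hmem 1 (by simp))
  · ext X
    constructor
    · rintro ⟨p, hp, rfl⟩
      obtain ⟨a, b, c, d, hx⟩ := exists_eval_eq_of_mem_degreeLT_four hp
      refine ⟨![c, b, a], -d, fun e => ?_⟩
      change (if e ∈ Finset.Icc 1 8 then _ else _) = if e ∈ Finset.Icc 1 8 then _ else _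
      rw [hx, one_mul]
      congr 2
      simp [dotProduct, Fin.sum_univ_three]
      ring
    · rintro ⟨w, a, h⟩
      obtain ⟨p, hp, hx⟩ := exists_mem_degreeLT_four (w 2) (w 1) (w 0) (-a)
      refine ⟨p, hp, ?_⟩
      funext e
      rw [h]
      change (if e ∈ Finset.Icc 1 8 then _ else _) = if e ∈ Finset.Icc 1 8 then _ else _
      rw [hx, one_mul]
      congr 2
      simp [dotProduct, Fin.sum_univ_three]
      ring

/-- The covectors of the alternating oriented matroid are orthogonal to its alternating circuits:
they have no weakly alternating subsequence of length five except zeros, by the linear relation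
between the values of a cubic polynomial at five points. -/
lemma alternating48_alt {X : SignedVec ℕ} (hX : X ∈ alternating48.covectors) {i j k l m : ℕ}
    (hi : 1 ≤ i) (hij : i < j) (hjk : j < k) (hkl : k < l) (hlm : l < m) (hm : m ≤ 8)
    (hXi : 0 ≤ X i) (hXj : X j ≤ 0) (hXk : 0 ≤ X k) (hXl : X l ≤ 0) (hXm : 0 ≤ X m) :
    X i = 0 ∧ X j = 0 ∧ X k = 0 ∧ X l = 0 ∧ X m = 0 := by
  obtain ⟨p, hp, rfl⟩ := hX
  obtain ⟨a, b, c, d, hx⟩ := exists_eval_eq_of_mem_degreeLT_four hp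
  rw [signVec_of_mem (by simp; omega)] at hXi hXj hXk hXl hXm ⊢
  rw [signVec_of_mem (by simp; omega), signVec_of_mem (by simp; omega),
    signVec_of_mem (by simp; omega), signVec_of_mem (by simp; omega)]
  simp only [sign_nonneg_iff, sign_nonpos_iff, sign_eq_zero_iff] at *
  have hij' : (0 : ℝ) < j - i := sub_pos.2 (by exact_mod_cast hij)
  have hjk' : (0 : ℝ) < k - j := sub_pos.2 (by exact_mod_cast hjk)
  have hkl' : (0 : ℝ) < l - k := sub_pos.2 (by exact_mod_cast hkl)
  have hlm' : (0 : ℝ) < m - l := sub_pos.2 (by exact_mod_cast hlm)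
  have hik' : (0 : ℝ) < k - i := by linarith
  have hil' : (0 : ℝ) < l - i := by linarith
  have him' : (0 : ℝ) < m - i := by linarith
  have hjl' : (0 : ℝ) < l - j := by linarith
  have hjm' : (0 : ℝ) < m - j := by linarith
  have hkm' : (0 : ℝ) < m - k := by linarith
  have hwi : (0 : ℝ) < (k - j) * (l - j) * (m - j) * (l - k) * (m - k) * (m - l) := by positivity
  have hwj : (0 : ℝ) < (k - i) * (l - i) * (m - i) * (l - k) * (m - k) * (m - l) := by positivity
  have hwk : (0 : ℝ) < (j - i) * (l - i) * (m - i) * (l - j) * (m - j) * (m - l) := by positivity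
  have hwl : (0 : ℝ) < (j - i) * (k - i) * (m - i) * (k - j) * (m - j) * (m - k) := by positivity
  have hwm : (0 : ℝ) < (j - i) * (k - i) * (l - i) * (k - j) * (l - j) * (l - k) := by positivity
  have hrel : ((k - j) * (l - j) * (m - j) * (l - k) * (m - k) * (m - l) : ℝ) * p.eval (i : ℝ)
      - (k - i) * (l - i) * (m - i) * (l - k) * (m - k) * (m - l) * p.eval (j : ℝ)
      + (j - i) * (l - i) * (m - i) * (l - j) * (m - j) * (m - l) * p.eval (k : ℝ)
      - (j - i) * (k - i) * (m - i) * (k - j) * (m - j) * (m - k) * p.eval (l : ℝ)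
      + (j - i) * (k - i) * (l - i) * (k - j) * (l - j) * (l - k) * p.eval (m : ℝ) = 0 := by
    simp only [hx]
    ring
  have h1 := mul_nonneg hwi.le hXi
  have h2 := mul_nonpos_of_nonneg_of_nonpos hwj.le hXj
  have h3 := mul_nonneg hwk.le hXk
  have h4 := mul_nonpos_of_nonneg_of_nonpos hwl.le hXl
  have h5 := mul_nonneg hwm.le hXm
  refine ⟨?_, ?_, ?_, ?_, ?_⟩
  · exact (mul_eq_zero.1 (by linarith : _ * p.eval (i : ℝ) = 0)).resolve_left hwi.ne'
  · exact (mul_eq_zero.1 (by linarith : _ * p.eval (j : ℝ) = 0)).resolve_left hwj.ne'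
  · exact (mul_eq_zero.1 (by linarith : _ * p.eval (k : ℝ) = 0)).resolve_left hwk.ne'
  · exact (mul_eq_zero.1 (by linarith : _ * p.eval (l : ℝ) = 0)).resolve_left hwl.ne'
  · exact (mul_eq_zero.1 (by linarith : _ * p.eval (m : ℝ) = 0)).resolve_left hwm.ne'

lemma exists_mem_degreeLT_two (a b : ℝ) :
    ∃ p ∈ degreeLT ℝ 2, ∀ x, p.eval x = a * x + b :=
  ⟨C a * X + C b, mem_degreeLT.2 (degree_linear_le.trans_lt (by norm_num)), fun x => by simp⟩

lemma exists_eval_eq_of_mem_degreeLT_two {p : ℝ[X]} (hp : p ∈ degreeLT ℝ 2) :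
    ∃ a b : ℝ, ∀ x, p.eval x = a * x + b := by
  refine ⟨p.coeff 1, p.coeff 0, fun x => ?_⟩
  have h2 : p.natDegree < 2 := by
    by_cases h0 : p = 0
    · simp [h0]
    · exact (natDegree_lt_iff_degree_lt h0).2 (by simpa using mem_degreeLT.1 hp)
  rw [eval_eq_sum_range' h2]
  simp [Finset.sum_range_succ]
  ring

/-- A cubic polynomial with the signs of `2 * sigma8 e - n` at `e = 1, …, 8`. It has a double zero
where this number vanishes and a simple zero at each remaining change of sign. If `n` separates two
of the pairs exchanged by `sigma8`, there is just one change, and the factor `(2 * e) * (2 * e)` is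
only there for uniformity. -/
lemma sigma8_threshold : ∀ n ∈ Finset.Icc (1 : ℤ) 17, ∀ e ∈ Finset.Icc (1 : ℕ) 8,
    SignType.sign (2 * (sigma8 e : ℤ) - n) = SignType.sign (
      if n % 4 = 1 then (2 * e - n) * (2 * e) * (2 * e)
      else if n % 4 = 2 then (2 * e - (n - 1)) * (2 * e - (n + 2)) * (2 * e - (n + 2))
      else if n % 4 = 3 then (2 * e - (n - 2)) * (2 * e - n) * (2 * e - (n + 2))
      else (2 * e - (n - 2)) * (2 * e - (n - 2)) * (2 * e - (n + 1))) := by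
  decide

lemma sign_intCast_real (n : ℤ) : SignType.sign (n : ℝ) = SignType.sign n := by
  rcases lt_trichotomy n 0 with h | rfl | h
  · rw [sign_neg h, sign_neg (by exact_mod_cast h)]
  · simp
  · rw [sign_pos h, sign_pos (by exact_mod_cast h)]

/-- Only the position of a threshold relative to the integers `1, …, 8` matters. -/
lemma exists_int_threshold (θ : ℝ) : ∃ n ∈ Finset.Icc (1 : ℤ) 17, ∀ k : ℕ, 1 ≤ k → k ≤ 8 →
    SignType.sign ((k : ℝ) - θ) = SignType.sign (2 * (k : ℤ) - n) := by
  have hfc := Int.floor_le_ceil θ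
  have hcf := Int.ceil_le_floor_add_one θ
  refine ⟨max 1 (min 17 (⌊θ⌋ + ⌈θ⌉)), by simp, fun k hk1 hk8 => ?_⟩
  rcases lt_trichotomy (k : ℝ) θ with h | h | h
  · have h1 : (k : ℤ) ≤ ⌊θ⌋ := Int.le_floor.2 (by exact_mod_cast h.le)
    have h2 : (k : ℤ) < ⌈θ⌉ := Int.lt_ceil.2 (by exact_mod_cast h)
    rw [sign_neg (sub_neg.2 h), sign_neg (by omega)]
  · have h1 : ⌊θ⌋ = k := by rw [← h]; simp
    have h2 : ⌈θ⌉ = k := by rw [← h]; simp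
    have h3 : 2 * (k : ℤ) - max 1 (min 17 (⌊θ⌋ + ⌈θ⌉)) = 0 := by omega
    rw [h, sub_self, h3, sign_zero, sign_zero]
  · have h1 : ⌊θ⌋ < (k : ℤ) := Int.floor_lt.2 (by exact_mod_cast h)
    have h2 : ⌈θ⌉ ≤ (k : ℤ) := Int.ceil_le.2 (by exact_mod_cast h.le)
    rw [sign_pos (sub_pos.2 h), sign_pos (by omega)]

lemma exists_cubic_of_threshold (θ : ℝ) : ∃ p ∈ degreeLT ℝ 4, ∀ e ∈ Finset.Icc (1 : ℕ) 8,
    SignType.sign (p.eval (e : ℝ)) = SignType.sign ((sigma8 e : ℝ) - θ) := by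
  have hσ : ∀ e ∈ Finset.Icc (1 : ℕ) 8, 1 ≤ sigma8 e ∧ sigma8 e ≤ 8 := by decide
  obtain ⟨n, hn, hθ⟩ := exists_int_threshold θ
  have cubic : ∀ u v w : ℤ, ∃ p ∈ degreeLT ℝ 4, ∀ e : ℕ,
      p.eval (e : ℝ) = (((2 * e - u) * (2 * e - v) * (2 * e - w) : ℤ) : ℝ) := by
    intro u v w
    obtain ⟨p, hp, hx⟩ := exists_mem_degreeLT_four 8 (-4 * (u + v + w))
      (2 * (u * v + u * w + v * w)) (-(u * v * w))
    exact ⟨p, hp, fun e => by rw [hx]; push_cast; ring⟩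
  have key : ∃ p ∈ degreeLT ℝ 4, ∀ e : ℕ, p.eval (e : ℝ) = ((if n % 4 = 1 then
      (2 * e - n) * (2 * e) * (2 * e)
      else if n % 4 = 2 then (2 * e - (n - 1)) * (2 * e - (n + 2)) * (2 * e - (n + 2))
      else if n % 4 = 3 then (2 * e - (n - 2)) * (2 * e - n) * (2 * e - (n + 2))
      else (2 * e - (n - 2)) * (2 * e - (n - 2)) * (2 * e - (n + 1)) : ℤ) : ℝ) := by
    split_ifs
    · simpa using cubic n 0 0
    · exact cubic _ _ _
    · exact cubic _ _ _
    · exact cubic _ _ _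
  obtain ⟨p, hp, hx⟩ := key
  refine ⟨p, hp, fun e he => ?_⟩
  rw [hx, sign_intCast_real, ← sigma8_threshold n hn e he, hθ _ (hσ e he).1 (hσ e he).2]

lemma isStrongMap_alternating48_permSigma8 : alternating48.IsStrongMap permSigma8 := by
  refine ⟨rfl, ?_⟩
  rintro _ ⟨p, hp, rfl⟩
  obtain ⟨a, b, hx⟩ := exists_eval_eq_of_mem_degreeLT_two hp
  suffices h : ∃ q ∈ degreeLT ℝ 4, ∀ e ∈ Finset.Icc (1 : ℕ) 8,
      SignType.sign (q.eval (e : ℝ)) = SignType.sign (-a * (sigma8 e : ℝ) + b) by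
    obtain ⟨q, hq, hqe⟩ := h
    refine ⟨q, hq, ?_⟩
    funext e
    by_cases he : e ∈ Finset.Icc 1 8
    · rw [signVec_of_mem he, signVec_of_mem he, hqe e he, hx]
      ring_nf
    · rw [signVec_of_notMem he, signVec_of_notMem he]
  rcases eq_or_ne a 0 with rfl | ha
  · obtain ⟨q, hq, hqe⟩ := exists_mem_degreeLT_four 0 0 0 b
    exact ⟨q, hq, fun e _ => by rw [hqe]; simp⟩
  · obtain ⟨q, hq, hqe⟩ := exists_cubic_of_threshold (b / a)
    refine ⟨-a • q, Submodule.smul_mem _ _ hq, fun e he => ?_⟩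
    rw [eval_smul, smul_eq_mul, sign_mul, hqe e he, ← sign_mul]
    congr 1
    field_simp
    ring

/-- The cocircuit of the rank two oriented matroid that vanishes at `i`. -/
lemma cocircuit_mem_permSigma8 (i : ℕ) : (fun e => if e ∈ Finset.Icc 1 8 then
    SignType.sign ((sigma8 e : ℤ) - sigma8 i) else 0) ∈ permSigma8.covectors := by
  obtain ⟨p, hp, hx⟩ := exists_mem_degreeLT_two (-1) (-(sigma8 i : ℝ))
  refine ⟨p, hp, ?_⟩
  funext e
  by_cases he : e ∈ Finset.Icc 1 8
  · rw [signVec_of_mem he, hx, if_pos he, ← sign_intCast_real]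
    congr 1
    push_cast
    ring
  · rw [signVec_of_notMem he, if_neg he]

/-! ### There is no intermediate oriented matroid of rank three -/

/-- Six elements of an oriented matroid of rank three, taken with signs, form a `SixFrame` if
they have the required sign vectors. The uniqueness of the vectors vanishing at two elements comes
from the rank. -/
lemma sixFrame_of_rank_eq_three {M : OrientedMatroid ℕ} (hM : M.rank = 3)
    (hM₂ : M.IsStrongMap permSigma8) (e : Fin 6 → ℕ) (t : Fin 6 → SignType) (ht : ∀ k, t k ≠ 0)
    (he : ∀ k, e k ∈ Finset.Icc 1 8) (hinj : e 3 ≠ e 4)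
    (alt : ∀ X ∈ M.covectors, ∀ a b c d f, a < b → b < c → c < d → d < f →
      0 ≤ t a * X (e a) → t b * X (e b) ≤ 0 → 0 ≤ t c * X (e c) → t d * X (e d) ≤ 0 →
      0 ≤ t f * X (e f) → t a * X (e a) = 0 ∧ t b * X (e b) = 0 ∧ t c * X (e c) = 0 ∧
        t d * X (e d) = 0 ∧ t f * X (e f) = 0)
    (mem₀ : ∃ X ∈ M.covectors, (fun k => t k * X (e k)) = ![0, -1, 1, 1, 1, 1])
    (mem₃ : ∃ X ∈ M.covectors, (fun k => t k * X (e k)) = ![-1, -1, 1, 0, 1, 1])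
    (mem₄ : ∃ X ∈ M.covectors, (fun k => t k * X (e k)) = ![-1, -1, -1, -1, 0, -1]) :
    SixFrame {Y | ∃ X ∈ M.covectors, (fun k => t k * X (e k)) = Y} where
  neg_mem := by
    rintro _ ⟨X, hX, rfl⟩
    exact ⟨-X, M.neg_mem X hX, by funext k; simp⟩
  elim := by
    rintro _ ⟨X, hX, rfl⟩ _ ⟨Y, hY, rfl⟩ k hk
    have hsep : ∀ a x y : SignType, a ≠ 0 → (a * x = -(a * y) ∧ a * x ≠ 0 ↔ x = -y ∧ x ≠ 0) := by
      decide
    obtain ⟨Z, hZ, hZk, hZf⟩ := M.elim X hX Y hY (e k) ((hsep _ _ _ (ht k)).1 hk)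
    refine ⟨_, ⟨Z, hZ, rfl⟩, by simp [hZk], fun f hf => ?_⟩
    have := hZf (e f) fun h => hf ((hsep _ _ _ (ht f)).2 h)
    simp only [this, SignedVec.comp]
    by_cases h : X (e f) = 0 <;> simp [h, ht f]
  alt := by
    rintro _ ⟨X, hX, rfl⟩
    exact alt X hX
  mem₀ := mem₀
  mem₃ := mem₃
  mem₄ := mem₄
  eq_zero := by
    rintro _ ⟨Z, hZ, rfl⟩ hZ3 hZ4 hZ0 _ ⟨W, hW, rfl⟩ hW3 hW4 hW0
    have h0 : ∀ k (X : SignedVec ℕ), t k * X (e k) = 0 → X (e k) = 0 := fun k X h =>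
      (mul_eq_zero.1 h).resolve_left (ht k)
    have hne : ∀ i ∈ Finset.Icc 1 8, ∀ j, i ≠ j →
        (if i ∈ Finset.Icc 1 8 then SignType.sign ((sigma8 i : ℤ) - sigma8 j) else 0) ≠ 0 := by
      intro i hi j hij
      rw [if_pos hi, sign_ne_zero, sub_ne_zero]
      exact_mod_cast sigma8.injective.ne hij
    have := eq_zero_of_rank_eq_three hM (i := e 3) (j := e 4) (k := e 0)
      (hM₂.2 (cocircuit_mem_permSigma8 (e 4))) (hM₂.2 (cocircuit_mem_permSigma8 (e 3))) hZ hW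
      (hne _ (he 3) _ hinj) (by simp) (hne _ (he 4) _ hinj.symm) (h0 3 Z hZ3) (h0 4 Z hZ4)
      (fun h => hZ0 (by simp [h])) (h0 3 W hW3) (h0 4 W hW4) (h0 0 W hW0)
    funext k
    simp [this]

/-- The covector that vanishes at `1` and `5` would have equal signs at `2` and `6`, by the
configuration on `1, 2, 3, 4, 5, 6`, and opposite signs, by the configuration on
`5, 6, 7, 8, -1, -2`. -/
theorem not_exists_rank_three : ¬∃ M : OrientedMatroid ℕ, M.rank = 3 ∧
    alternating48.IsStrongMap M ∧ M.IsStrongMap permSigma8 := by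
  rintro ⟨M, hM, hM₁, hM₂⟩
  have hground : M.ground = Finset.Icc 1 8 := hM₁.1.symm
  obtain ⟨X, hX, hX0, hXne⟩ := exists_covector_of_card_lt_rank (M := M) (B := {1, 5})
    (by rw [hground]; decide) (by rw [hM]; decide)
  have hX1 : X 1 = 0 := hX0 1 (by simp)
  have hX5 : X 5 = 0 := hX0 5 (by simp)
  -- a nonzero covector of the alternating oriented matroid has at most three zeros
  have hzeros : ∀ Z ⊆ Finset.Icc 1 8, 4 ≤ Z.card → ∃ z ∈ Z, X z ≠ 0 := by
    intro Z hZ hc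
    by_contra! h
    obtain ⟨p, hp, hXp⟩ := hM₁.2 hX
    refine hXne ?_
    rw [hXp, eq_zero_of_mem_degreeLT injOn_natCast hp hZ hc fun z hz => ?_]
    · funext e
      simp [signVec]
    · have := h z hz
      rwa [hXp, signVec_of_mem (hZ hz), sign_eq_zero_iff] at this
  have alt := fun Y hY => @alternating48_alt Y (hM₁.2 hY)
  have cocircuit := fun i => hM₂.2 (cocircuit_mem_permSigma8 i)
  have frame₁ : SixFrame {Y | ∃ X ∈ M.covectors,
      (fun k => (fun _ => 1 : Fin 6 → SignType) k * X ((fun k => (k : ℕ) + 1 : Fin 6 → ℕ) k)) = Y} := by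
    refine sixFrame_of_rank_eq_three hM hM₂ _ _ (by simp) (by decide) (by decide) ?_
      ⟨_, cocircuit 1, by decide⟩ ⟨_, cocircuit 4, by decide⟩ ⟨_, cocircuit 5, by decide⟩
    intro Y hY a b c d f hab hbc hcd hdf
    simp only [one_mul]
    exact alt Y hY (by omega) (by omega) (by omega) (by omega) (by omega) (by omega)
  have frame₂ : SixFrame {Y | ∃ X ∈ M.covectors,
      (fun k => (![1, 1, 1, 1, -1, -1] : Fin 6 → SignType) k *
        X ((![5, 6, 7, 8, 1, 2] : Fin 6 → ℕ) k)) = Y} := by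
    refine sixFrame_of_rank_eq_three hM hM₂ _ _ (by decide) (by decide) (by decide) ?_
      ⟨_, cocircuit 5, by decide⟩ ⟨_, cocircuit 8, by decide⟩
      ⟨_, M.neg_mem _ (cocircuit 1), by decide⟩
    intro Y hY a b c d f hab hbc hcd hdf
    have lo : ∀ k : Fin 6, k < 4 → (![1, 1, 1, 1, -1, -1] : Fin 6 → SignType) k = 1 ∧
        (![5, 6, 7, 8, 1, 2] : Fin 6 → ℕ) k = k + 5 := by decide
    have hi : ∀ k : Fin 6, 3 < k → (![1, 1, 1, 1, -1, -1] : Fin 6 → SignType) k = -1 ∧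
        1 ≤ (![5, 6, 7, 8, 1, 2] : Fin 6 → ℕ) k ∧ (![5, 6, 7, 8, 1, 2] : Fin 6 → ℕ) k ≤ 2 := by
      decide
    have hneg : ∀ s : SignType, (0 ≤ -s ↔ s ≤ 0) ∧ (-s ≤ 0 ↔ 0 ≤ s) ∧ (-s = 0 ↔ s = 0) := by
      decide
    rw [(lo a (by omega)).1, (lo a (by omega)).2, (lo b (by omega)).1, (lo b (by omega)).2,
      (lo c (by omega)).1, (lo c (by omega)).2, (hi f (by omega)).1]
    have hf := (hi f (by omega)).2
    by_cases hd : d < 4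
    · -- one of the five elements wraps around
      rw [(lo d hd).1, (lo d hd).2]
      generalize (![5, 6, 7, 8, 1, 2] : Fin 6 → ℕ) f = f' at hf
      simp only [one_mul, neg_mul, hneg]
      intro ha hb hc hd' hf'
      have := alt (-Y) (M.neg_mem Y hY) (i := f') (j := a + 5) (k := b + 5) (l := c + 5)
        (m := d + 5) (by omega) (by omega) (by omega) (by omega) (by omega) (by omega)
      simp only [Pi.neg_apply, hneg] at this
      obtain ⟨h1, h2, h3, h4, h5⟩ := this hf' ha hb hc hd'
      exact ⟨h2, h3, h4, h5, h1⟩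
    · -- two of the five elements wrap around
      obtain rfl : d = 4 := by omega
      obtain rfl : f = 5 := by omega
      change _ → _ → _ → -1 * Y 1 ≤ 0 → 0 ≤ -1 * Y 2 → _ ∧ _ ∧ _ ∧ -1 * Y 1 = 0 ∧ -1 * Y 2 = 0
      simp only [one_mul, neg_mul, hneg]
      intro ha hb hc hd' hf'
      obtain ⟨h1, h2, h3, h4, h5⟩ := alt Y hY (i := 1) (j := 2) (k := a + 5) (l := b + 5)
        (m := c + 5) (by omega) (by omega) (by omega) (by omega) (by omega) (by omega)
        hd' hf' ha hb hc
      exact ⟨h3, h4, h5, h1, h2⟩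
  have h₁ := frame₁.eq_and_ne_zero ⟨X, hX, rfl⟩ (fun h => by
    obtain ⟨z, hz, hz0⟩ := hzeros {1, 2, 3, 4} (by decide) (by decide)
    simp only [Finset.mem_insert, Finset.mem_singleton] at hz
    rcases hz with rfl | rfl | rfl | rfl
    · exact hz0 (by simpa using congrFun h 0)
    · exact hz0 (by simpa using congrFun h 1)
    · exact hz0 (by simpa using congrFun h 2)
    · exact hz0 (by simpa using congrFun h 3)) (by simp [hX1]) (by simp [hX5])
  have h₂ := frame₂.eq_and_ne_zero ⟨X, hX, rfl⟩ (fun h => by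
    obtain ⟨z, hz, hz0⟩ := hzeros {5, 6, 7, 8} (by decide) (by decide)
    simp only [Finset.mem_insert, Finset.mem_singleton] at hz
    rcases hz with rfl | rfl | rfl | rfl
    · exact hz0 (by simpa using congrFun h 0)
    · exact hz0 (by simpa using congrFun h 1)
    · exact hz0 (by simpa using congrFun h 2)
    · exact hz0 (by simpa using congrFun h 3)) (by simp [hX5]) (by simp [hX1])
  have h₁' : X 2 = X 6 ∧ X 2 ≠ 0 := by simpa using h₁
  have h₂' : X 6 = -X 2 ∧ X 6 ≠ 0 := by simpa using h₂
  have hno : ∀ x y : SignType, ¬((x = y ∧ x ≠ 0) ∧ y = -x ∧ y ≠ 0) := by decide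
  exact hno _ _ ⟨h₁', h₂'⟩

end OrientedMatroid

theorem mainTheorem1 :
    ∃ M₁ M₂ : OrientedMatroid ℕ,
      M₁.ground = Finset.Icc 1 8 ∧ M₂.ground = Finset.Icc 1 8 ∧
      M₁.rank = 4 ∧ M₂.rank = 2 ∧
      M₁.IsAlternating 4 8 ∧ M₂.IsGivenByPerm 8 sigma8 ∧
      M₁.IsRealizable ∧
      M₁.IsStrongMap M₂ ∧ M₁.corank M₂ = 2 ∧
      ¬ M₁.IsFactorizable M₂ ∧
      ¬ ∃ M' : OrientedMatroid ℕ,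
        M'.IsUniform ∧ M'.rank = 3 ∧ M₁.IsStrongMap M' ∧ M'.IsStrongMap M₂ := by
  open OrientedMatroid in
  refine ⟨alternating48, permSigma8, rfl, rfl, rank_alternating48, rank_permSigma8,
    isAlternating_alternating48, isGivenByPerm_permSigma8, isRealizable_alternating48,
    isStrongMap_alternating48_permSigma8, ?_, fun h => ?_, fun ⟨M', _, h⟩ => ?_⟩
  · simp [corank, rank_alternating48, rank_permSigma8]
  · exact not_exists_rank_three (h.exists_rank_eq (by rw [rank_alternating48]; norm_num)
      (by rw [rank_permSigma8]; norm_num))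
  · exact not_exists_rank_three ⟨M', h⟩
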